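/- Let $\mathbb D$ be the open unit disk in $\mathbb C$, let $dA$ be area measure on $\mathbb D$ normalized so that $\mathbb D$ has measure $1$, and write $|E|$ for the $dA$-measure of $E$. For a weight $\omega$ on $\mathbb D$ write $|E|_\omega=\int_E\omega\,dA$, and let $B(a,r)=\{z\in\mathbb D:|z-a|<r\}$. An integrable function $\omega>0$ on $\mathbb D$ is an $\mathcal A_2$ weight if $$\sup_{a\in\mathbb D,\ 0<r<1}\frac{|B(a,r)|_\omega\,|B(a,r)|_{\omega^{-1}}}{|B(a,r)|^2}<\infty .$$ Let $L^2_h(\omega)$ be the space of complex-valued harmonic functions on $\mathbb D$ that belong to $L^2(\omega)=L^2(\mathbb D,\omega\,dA)$, with the norm and inner product of $L^2(\omega)$. For an $\mathcal A_2$ weight it is a reproducing kernel Hilbert space; let $K^\omega_z\in L^2_h(\omega)$ be its kernel, so that $f(z)=\langle f,K^\omega_z\rangle_{L^2(\omega)}$ for all $f\in L^2_h(\omega)$ and $z\in\mathbb D$. For $z,\lambda\in\mathbb D$ let $$D(z,r)=\Big\{w\in\mathbb D:\Big|\frac{w-z}{1-\bar z w}\Big|<r\Big\},\qquad R_z(\lambda)=\frac1{(1-\bar\lambda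 z)^2}+\frac1{(1-\bar z\lambda)^2}-1 .$$ **Theorem.** Let $\omega$ be an $\mathcal A_2$ weight, let $\nu$ be a positive finite Borel measure on $\mathbb D$, and let $r_0\in(0,\frac14]$. Let $\mathcal D$ be any linear subspace of $L^2_h(\omega)$ that contains all kernels $K^\omega_a$, $a\in\mathbb D$ (for instance their linear span; such a $\mathcal D$ is dense). The following conditions are equivalent. 1. The Toeplitz operator $T_\nu$ with domain $\mathcal D$ is defined and extends to a bounded linear operator on $L^2_h(\omega)$; that is, there is a bounded linear operator $T$ on $L^2_h(\omega)$ such that, for all $f\in\mathcal D$ and $z\in\mathbb D$, $$Tf(z)=\int_{\mathbb D}f(\lambda)\overline{K^\omega_z(\lambda)}\,d\nu(\lambda),$$ where the integral converges absolutely. 2. $\nu$ is a Carleson measure for $L^2_h(\omega)$: there is a constant $C$ such that $\int_{\mathbb D}|f|^2\,d\nu\le C\|f\|^2_{L^2(\omega)}$ for all $f\in L^2_h(\omega)$. 3. There are $r\in(0,r_0]$ and a constant $C$ such that $\nu(D(z,r))\le C\,|D(z,r)|_\omega$ for all $z\in\mathbb D$. 4. The Berezin transform $$\widetilde\nu(z)=\frac1{\|R_z\|^2_{L^2(\omega)}}\int_{\mathbb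 D}|R_z(\lambda)|^2\,d\nu(\lambda)$$ is bounded on $\mathbb D$. -/

import Mathlib

open MeasureTheory Metric
open scoped ENNReal NNReal ComplexConjugate

noncomputable section

namespace HarmonicBergman

/-- The open unit disk. -/
def disk : Set ℂ := ball (0 : ℂ) 1

/-- Area measure on the unit disk, normalized so that the disk has measure one
(as a measure on `ℂ`, it vanishes outside the disk). -/
def dA : Measure ℂ := (ENNReal.ofReal Real.pi)⁻¹ • volume.restrict disk

/-- `ω` is a Muckenhoupt `A₂` weight on the disk. As `dA` lives on the disk, the integrals over
`ball a r` are integrals over the part of that ball which lies in the disk. -/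
structure IsA2Weight (ω : ℂ → ℝ) : Prop where
  pos : ∀ᵐ z ∂dA, 0 < ω z
  integrable : Integrable ω dA
  bound : ∃ C : ℝ≥0, ∀ a ∈ disk, ∀ r : ℝ, 0 < r → r < 1 →
    (∫⁻ z in ball a r, ENNReal.ofReal (ω z) ∂dA) *
      (∫⁻ z in ball a r, ENNReal.ofReal ((ω z)⁻¹) ∂dA) ≤ C * dA (ball a r) ^ 2

/-- The measure `ω dA` on the disk; its value at `E` is `|E|_ω`. -/
def weightMeasure (ω : ℂ → ℝ) : Measure ℂ := dA.withDensity fun z => ENNReal.ofReal (ω z)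

/-- The weighted harmonic Bergman space `L²_h(ω)`: the elements of `L²(ω)` that are represented
by a (complex valued) harmonic function on the disk, with the norm of `L²(ω)`. -/
def L2h (ω : ℂ → ℝ) : Submodule ℂ (Lp ℂ 2 (weightMeasure ω)) where
  carrier := {f | ∃ g : ℂ → ℂ, InnerProductSpace.HarmonicOnNhd g disk ∧ f =ᵐ[weightMeasure ω] g}
  add_mem' := by
    rintro f₁ f₂ ⟨g₁, h₁, e₁⟩ ⟨g₂, h₂, e₂⟩
    exact ⟨g₁ + g₂, h₁.add h₂, (Lp.coeFn_add f₁ f₂).trans (e₁.add e₂)⟩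
  zero_mem' := ⟨fun _ => 0, by simp, Lp.coeFn_zero _ _ _⟩
  smul_mem' := by
    rintro c f ⟨g, h, e⟩
    refine ⟨c • g, fun z hz => ?_, (Lp.coeFn_smul c f).trans (e.const_smul c)⟩
    have hl := ((h z hz).comp_CLM (l := c • ContinuousLinearMap.id ℝ ℂ))
    exact hl

/-- The harmonic function on the disk that an element of `L²_h(ω)` is; its values on the disk are
uniquely determined when `ω > 0` almost everywhere, and its values outside the disk are irrelevant. -/
def fn {ω : ℂ → ℝ} (f : L2h ω) : ℂ → ℂ := f.2.choose

open Classical in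
/-- The reproducing kernel `K^ω_z` of `L²_h(ω)`: the unique element of `L²_h(ω)` with
`f(z) = ⟨f, K^ω_z⟩ = ∫ f(λ) conj(K^ω_z(λ)) ω(λ) dA(λ)` for all `f` in `L²_h(ω)`.
(`inner ℂ k f` is conjugate linear in `k`.) For an `A₂` weight `ω` and `z` in the disk it exists,
so that the second branch is never used. -/
def kernel (ω : ℂ → ℝ) (z : ℂ) : L2h ω :=
  if h : ∃ k : L2h ω, ∀ f : L2h ω, inner ℂ k f = fn f z then h.choose else 0

/-- `T_ν`, defined on the subspace `𝒟` of `L²_h(ω)` by the absolutely convergent integrals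
`T_ν f(z) = ∫ f(λ) conj(K^ω_z(λ)) dν(λ)`, extends to a bounded linear operator on `L²_h(ω)`. -/
def ToeplitzExtends (ω : ℂ → ℝ) (ν : Measure ℂ) (𝒟 : Submodule ℂ (L2h ω)) : Prop :=
  ∃ T : L2h ω →L[ℂ] L2h ω, ∀ f ∈ 𝒟, ∀ z ∈ disk,
    Integrable (fun w => fn f w * conj (fn (kernel ω z) w)) ν ∧
      fn (T f) z = ∫ w, fn f w * conj (fn (kernel ω z) w) ∂ν

/-- `ν` is a Carleson measure for `L²_h(ω)`. -/
def IsCarleson (ω : ℂ → ℝ) (ν : Measure ℂ) : Prop :=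
  ∃ C : ℝ≥0, ∀ f : L2h ω, ∫⁻ w, ‖fn f w‖ₑ ^ 2 ∂ν ≤ C * ‖f‖ₑ ^ 2

/-- The pseudohyperbolic disk `D(z, r)`. -/
def pdisk (z : ℂ) (r : ℝ) : Set ℂ := {w ∈ disk | ‖(w - z) / (1 - conj z * w)‖ < r}

/-- The reproducing kernel `R_z(w)` of the unweighted harmonic Bergman space. -/
def R (z w : ℂ) : ℂ := 1 / (1 - conj w * z) ^ 2 + 1 / (1 - conj z * w) ^ 2 - 1

/-- The Berezin transform of `ν`. -/
def berezin (ω : ℂ → ℝ) (ν : Measure ℂ) (z : ℂ) : ℝ :=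
  (1 / ∫ w, ‖R z w‖ ^ 2 ∂weightMeasure ω) * ∫ w, ‖R z w‖ ^ 2 ∂ν

end HarmonicBergman

end

/-!
Write `μ = ω dA`, `σ = ω⁻¹ dA` and `δ = 1 - |z|`. The Muckenhoupt condition and the Cauchy–Schwarz
inequality give `μ(B)σ(B) ≤ C r⁴` for balls of all radii centred in the disk, with a matching lower
bound for balls inside the disk, hence doubling for both measures (`IsA2Pair.doubling`). By the mean
value property, a harmonic `f` satisfies `|f(w)|² μ(B) ≤ C ∫_B |f|² dμ` for balls `B` in the disk
centred at `w` (`IsA2Pair.enorm_sq_mul_measure_ball_le`). So point evaluations are bounded on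
`L²_h(ω)`, which is complete because locally uniform limits of harmonic functions are harmonic, and
the kernels exist (`IsA2Weight.inner_kernel`).

The test functions are the unweighted kernels `R_z`, for which `|R_z(z)| ≥ 1 / (4δ²)` and
`‖R_z‖² ≤ A μ(B(z, δ)) / δ⁴` (`IsA2Pair.exists_lintegral_R_le`). In the second bound doubling alone
would leave a divergent sum over dyadic shells. However, on a shell of radius `s` the integrand
contributes at most a constant over `σ(B(z, s))`, and `σ(B(z, s))` grows geometrically with `s` by
reverse doubling (`IsA2Pair.exists_lintegral_compl_ball_mul_le`).

* A bound on `ν(D(z, r))` gives the Carleson property: integrate the pointwise bound on small balls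
  against `ν` and exchange the integrals (`isCarleson_of_pdisk_le`).
* The Carleson embedding `ι : L²_h(ω) → L²(ν)` is bounded exactly when `ν` is Carleson, and then
  `ι* ι` extends `T_ν` (`IsCarleson.toeplitzExtends`); testing on `R_z` bounds the Berezin transform
  (`IsCarleson.exists_berezin_le`).
* Conversely, if `∫ |f|² dν ≤ C ‖f‖²` for `f = R_z`, or for `f = K_z`, where the left hand side
  is `⟨T K_z, K_z⟩`, then `ν(D(z, r))` is controlled, because on a small pseudohyperbolic disk around
  `z` such an `f` stays above half of its value at `z`: Borel–Carathéodory bounds the oscillation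
  of a bounded harmonic function (`measure_pdisk_mul_le`).
-/

namespace HarmonicBergman

/-! ### Area measure and the geometry of the disk -/

lemma mem_disk {z : ℂ} : z ∈ disk ↔ ‖z‖ < 1 := by simp [disk]

lemma isOpen_disk : IsOpen disk := isOpen_ball

lemma measurableSet_disk : MeasurableSet disk := measurableSet_ball

lemma ae_mem_disk {ν : Measure ℂ} (hν : ν diskᶜ = 0) : ∀ᵐ z ∂ν, z ∈ disk := mem_ae_iff.2 hν

lemma dA_apply {E : Set ℂ} (hE : MeasurableSet E) :
    dA E = (ENNReal.ofReal Real.pi)⁻¹ * volume (E ∩ disk) := by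
  simp [dA, Measure.restrict_apply hE]

lemma inv_pi_mul_volume_ball (a : ℂ) {r : ℝ} (hr : 0 ≤ r) :
    (ENNReal.ofReal Real.pi)⁻¹ * volume (ball a r) = ENNReal.ofReal (r ^ 2) := by
  have hpi : (NNReal.pi : ℝ≥0∞) = ENNReal.ofReal Real.pi := by
    rw [← NNReal.coe_real_pi, ENNReal.ofReal_coe_nnreal]
  rw [Complex.volume_ball, hpi, mul_comm, mul_assoc, ENNReal.mul_inv_cancel, mul_one,
    ENNReal.ofReal_pow hr]
  · simp [Real.pi_pos]
  · simp

lemma dA_ball {a : ℂ} {r : ℝ} (hr : 0 ≤ r) (h : ball a r ⊆ disk) :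
    dA (ball a r) = ENNReal.ofReal (r ^ 2) := by
  rw [dA_apply measurableSet_ball, Set.inter_eq_left.2 h, inv_pi_mul_volume_ball a hr]

lemma dA_ball_le (a : ℂ) {r : ℝ} (hr : 0 ≤ r) : dA (ball a r) ≤ ENNReal.ofReal (r ^ 2) := by
  rw [dA_apply measurableSet_ball, ← inv_pi_mul_volume_ball a hr]
  gcongr
  exact Set.inter_subset_left

lemma dA_compl_disk : dA diskᶜ = 0 := by
  simp [dA_apply measurableSet_disk.compl]

lemma dA_disk : dA disk = 1 := by
  have := dA_ball (a := 0) (r := 1) (by norm_num) le_rfl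
  simpa [disk] using this

lemma setLIntegral_dA_ball {w : ℂ} {t : ℝ} (h : ball w t ⊆ disk) (f : ℂ → ℝ≥0∞) :
    ∫⁻ z in ball w t, f z ∂dA = (ENNReal.ofReal Real.pi)⁻¹ * ∫⁻ z in ball w t, f z := by
  rw [dA, Measure.restrict_smul, lintegral_smul_measure,
    Measure.restrict_restrict measurableSet_ball, Set.inter_eq_left.2 h, smul_eq_mul]

lemma ball_subset_disk {w : ℂ} {t : ℝ} (h : t ≤ 1 - ‖w‖) : ball w t ⊆ disk := by
  apply ball_subset_ball'
  simpa using by linarith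

/-- Moving the centre of a ball towards the origin gives a ball of comparable radius that lies both
in the ball and in the disk. -/
lemma exists_ball_subset_inter_disk {a : ℂ} (ha : a ∈ disk) {s : ℝ} (hs : 0 < s) (hs4 : s ≤ 4) :
    ∃ b, ball b (s / 4) ⊆ ball a s ∩ disk := by
  rw [mem_disk] at ha
  refine ⟨((1 - s / 4 : ℝ) : ℂ) * a, Set.subset_inter ?_ ?_⟩
  · apply ball_subset_ball'
    have : ((1 - s / 4 : ℝ) : ℂ) * a - a = ((-(s / 4) : ℝ) : ℂ) * a := by push_cast; ring
    rw [dist_eq_norm, this, norm_mul, Complex.norm_real, Real.norm_eq_abs, abs_neg,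
      abs_of_pos (by positivity)]
    nlinarith
  · apply ball_subset_disk
    rw [norm_mul, Complex.norm_real, Real.norm_eq_abs, abs_of_nonneg (by linarith)]
    nlinarith [norm_nonneg a]

/-- Inside the disk, the shell between two concentric balls of radii `s` and `2s` contains a ball of
radius comparable to `s`. -/
lemma exists_ball_subset_shell {a : ℂ} (ha : a ∈ disk) {s : ℝ} (hs : 0 < s) (hs2 : s ≤ 1 / 2) :
    ∃ b, ball b (s / 8) ⊆ (ball a (2 * s) \ ball a s) ∩ disk := by
  rw [mem_disk] at ha
  -- a point of the disk at distance `3s/2` from `a`, on the diameter through `a`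
  obtain ⟨c, hc, hac⟩ : ∃ c ∈ disk, dist c a = 3 / 2 * s := by
    by_cases h0 : a = 0
    · refine ⟨((3 / 2 * s : ℝ) : ℂ), ?_, ?_⟩
      · rw [mem_disk, Complex.norm_real, Real.norm_eq_abs, abs_of_pos (by positivity)]
        linarith
      · rw [h0, dist_zero_right, Complex.norm_real, Real.norm_eq_abs, abs_of_pos (by positivity)]
    · have hn : 0 < ‖a‖ := norm_pos_iff.2 h0
      refine ⟨((1 - 3 / 2 * s / ‖a‖ : ℝ) : ℂ) * a, ?_, ?_⟩
      · rw [mem_disk, norm_mul, Complex.norm_real, Real.norm_eq_abs, ← abs_of_pos hn, ← abs_mul,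
          abs_of_pos hn, abs_lt]
        have : (1 - 3 / 2 * s / ‖a‖) * ‖a‖ = ‖a‖ - 3 / 2 * s := by field_simp
        rw [this]
        constructor <;> linarith
      · have : ((1 - 3 / 2 * s / ‖a‖ : ℝ) : ℂ) * a - a = ((-(3 / 2 * s / ‖a‖) : ℝ) : ℂ) * a := by
          push_cast; ring
        rw [dist_eq_norm, this, norm_mul, Complex.norm_real, Real.norm_eq_abs, abs_neg,
          abs_of_pos (by positivity)]
        field_simp
  obtain ⟨b, hb⟩ := exists_ball_subset_inter_disk hc (s := s / 2) (by positivity) (by linarith)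
  refine ⟨b, fun w hw => ?_⟩
  have hw' := hb (by convert hw using 2; ring)
  have hwc : dist w c < s / 2 := hw'.1
  refine ⟨⟨?_, ?_⟩, hw'.2⟩
  · rw [mem_ball]
    linarith [dist_triangle w c a]
  · rw [mem_ball, not_lt]
    linarith [dist_triangle c w a, dist_comm c w]

/-! ### Weights satisfying the Muckenhoupt condition -/

/-- An upper bound for `μ(B)σ(B)` on a ball `B` of radius `r`, together with the matching lower bound
on a ball `B'` of radius `κr` inside `B`, bounds `μ(B)` by a multiple of `μ(E)` whenever
`B' ⊆ E ⊆ B`. -/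
lemma measure_ball_le_of_mul_le {μ σ : Measure ℂ} {C : ℝ} {a b : ℂ} {r κ : ℝ} (hr : 0 < r)
    (hκ : 0 < κ) (hmul : μ (ball a r) * σ (ball a r) ≤ ENNReal.ofReal (C * r ^ 4))
    (hpow : ENNReal.ofReal ((κ * r) ^ 4) ≤ μ (ball b (κ * r)) * σ (ball b (κ * r)))
    {E : Set ℂ} (hE : E ⊆ ball a r) (hbE : ball b (κ * r) ⊆ E) :
    μ (ball a r) ≤ ENNReal.ofReal (C / κ ^ 4) * μ E := by
  have h2 : ENNReal.ofReal ((κ * r) ^ 4) * μ (ball a r) ≤ μ E * ENNReal.ofReal (C * r ^ 4) := by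
    calc _ ≤ μ (ball b (κ * r)) * σ (ball b (κ * r)) * μ (ball a r) := by gcongr
      _ ≤ μ E * σ (ball a r) * μ (ball a r) := by gcongr; exact hbE.trans hE
      _ = μ E * (μ (ball a r) * σ (ball a r)) := by ring
      _ ≤ _ := by gcongr
  have h3 : ENNReal.ofReal (C * r ^ 4) =
      ENNReal.ofReal ((κ * r) ^ 4) * ENNReal.ofReal (C / κ ^ 4) := by
    rw [← ENNReal.ofReal_mul (by positivity)]
    congr 1
    field_simp
  rw [h3] at h2
  have h4 : ENNReal.ofReal ((κ * r) ^ 4) ≠ 0 := by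
    simp only [ne_eq, ENNReal.ofReal_eq_zero, not_le]; positivity
  rw [← ENNReal.mul_le_mul_iff_right h4 ENNReal.ofReal_ne_top]
  calc _ ≤ _ := h2
    _ = _ := by ring

/-- The consequences of the Muckenhoupt condition that are used for a weight measure `μ = ω dA` and
its dual `σ = ω⁻¹ dA`: the Cauchy–Schwarz inequality between the two, and the upper bound for
their product on balls of any radius centred in the disk. -/
structure IsA2Pair (μ σ : Measure ℂ) (C : ℝ) : Prop where
  pos : 0 < C
  finite : IsFiniteMeasure μ
  finite_dual : IsFiniteMeasure σ
  compl_disk : μ diskᶜ = 0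
  sq_lintegral_le : ∀ E, MeasurableSet E → ∀ f : ℂ → ℝ≥0∞, AEMeasurable f dA →
    (∫⁻ z in E, f z ∂dA) ^ 2 ≤ (∫⁻ z in E, f z ^ 2 ∂μ) * σ E
  mul_le : ∀ a ∈ disk, ∀ r : ℝ, 0 < r → μ (ball a r) * σ (ball a r) ≤ ENNReal.ofReal (C * r ^ 4)

namespace IsA2Pair

variable {μ σ : Measure ℂ} {C : ℝ}

lemma sq_dA_le (h : IsA2Pair μ σ C) {E : Set ℂ} (hE : MeasurableSet E) :
    dA E ^ 2 ≤ μ E * σ E := by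
  simpa using h.sq_lintegral_le E hE (fun _ => 1) aemeasurable_const

lemma pow_four_le (h : IsA2Pair μ σ C) {b : ℂ} {t : ℝ} (ht : 0 ≤ t) (hb : ball b t ⊆ disk) :
    ENNReal.ofReal (t ^ 4) ≤ μ (ball b t) * σ (ball b t) := by
  have := h.sq_dA_le (measurableSet_ball (x := b) (ε := t))
  rwa [dA_ball ht hb, ← ENNReal.ofReal_pow (by positivity), ← pow_mul] at this

/-- Doubling: `μ(B)` is at most a constant times `μ(E)` for a subset `E` of the ball `B` that
contains a ball of comparable size in the disk. -/
lemma doubling (h : IsA2Pair μ σ C) {a b : ℂ} (ha : a ∈ disk) {r κ : ℝ} (hr : 0 < r) (hκ : 0 < κ)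
    {E : Set ℂ} (hE : E ⊆ ball a r) (hb : ball b (κ * r) ⊆ E ∩ disk) :
    μ (ball a r) ≤ ENNReal.ofReal (C / κ ^ 4) * μ E :=
  measure_ball_le_of_mul_le hr hκ (h.mul_le a ha r hr)
    (h.pow_four_le (by positivity) (hb.trans Set.inter_subset_right)) hE
    (hb.trans Set.inter_subset_left)

/-- The dual measure satisfies the same doubling estimate. -/
lemma doubling_dual (h : IsA2Pair μ σ C) {a b : ℂ} (ha : a ∈ disk) {r κ : ℝ} (hr : 0 < r)
    (hκ : 0 < κ) {E : Set ℂ} (hE : E ⊆ ball a r) (hb : ball b (κ * r) ⊆ E ∩ disk) :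
    σ (ball a r) ≤ ENNReal.ofReal (C / κ ^ 4) * σ E :=
  measure_ball_le_of_mul_le hr hκ (mul_comm (μ (ball a r)) _ ▸ h.mul_le a ha r hr)
    (mul_comm (μ (ball b (κ * r))) _ ▸
      h.pow_four_le (by positivity) (hb.trans Set.inter_subset_right)) hE
    (hb.trans Set.inter_subset_left)

lemma measure_ball_pos (h : IsA2Pair μ σ C) {b : ℂ} {t : ℝ} (ht : 0 < t) (hb : ball b t ⊆ disk) :
    0 < μ (ball b t) := by
  rw [pos_iff_ne_zero]
  intro h0
  have := h.pow_four_le ht.le hb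
  rw [h0, zero_mul, nonpos_iff_eq_zero, ENNReal.ofReal_eq_zero] at this
  exact absurd this (not_le.2 (by positivity))

/-- Reverse doubling: the dual measure of a ball of radius at most `1/2` is at most a fixed
proportion of that of its double, as the shell between them is not negligible. -/
lemma exists_reverse_doubling_dual (h : IsA2Pair μ σ C) :
    ∃ q : ℝ, 0 ≤ q ∧ q < 1 ∧ ∀ a ∈ disk, ∀ s : ℝ, 0 < s → s ≤ 1 / 2 →
      σ (ball a s) ≤ ENNReal.ofReal q * σ (ball a (2 * s)) := by
  have := h.finite_dual
  set K : ℝ := C / (1 / 16) ^ 4 + 1 with hK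
  have hK1 : 1 < K := by have := h.pos; rw [hK]; linarith [show 0 < C / (1 / 16) ^ 4 by positivity]
  refine ⟨1 - 1 / K, ?_, ?_, fun a ha s hs hs2 => ?_⟩
  · rw [sub_nonneg, div_le_one (by linarith)]; exact hK1.le
  · have : 0 < 1 / K := by positivity
    linarith
  obtain ⟨b, hb⟩ := exists_ball_subset_shell ha hs hs2
  have h1 := h.doubling_dual (a := a) (b := b) ha (r := 2 * s) (κ := 1 / 16) (by positivity)
    (by norm_num) (E := ball a (2 * s) \ ball a s) Set.sdiff_subset
    (by convert hb using 2; ring)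
  have hsub : ball a s ⊆ ball a (2 * s) := ball_subset_ball (by linarith)
  have h2 : σ (ball a s) + σ (ball a (2 * s) \ ball a s) = σ (ball a (2 * s)) :=
    measure_add_sdiff measurableSet_ball.nullMeasurableSet _ |>.trans
      (by rw [Set.union_eq_self_of_subset_left hsub])
  have h1' := ENNReal.toReal_mono (by finiteness) h1
  have h2' := congrArg ENNReal.toReal h2
  rw [ENNReal.toReal_add (by finiteness) (by finiteness)] at h2'
  have hC := h.pos
  rw [ENNReal.toReal_mul, ENNReal.toReal_ofReal (by positivity)] at h1'
  rw [← ENNReal.toReal_le_toReal (by finiteness) (by finiteness), ENNReal.toReal_mul,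
    ENNReal.toReal_ofReal (by rw [sub_nonneg, div_le_one (by linarith)]; exact hK1.le)]
  set x := (σ (ball a s)).toReal
  set y := (σ (ball a (2 * s))).toReal
  set e := (σ (ball a (2 * s) \ ball a s)).toReal
  have he : 0 ≤ e := ENNReal.toReal_nonneg
  have hye : y ≤ K * e := by rw [hK]; linarith
  have : y / K ≤ e := by rw [div_le_iff₀ (by linarith)]; linarith
  rw [sub_mul, one_mul, one_div_mul_eq_div]
  linarith

/-- The integral of `|z - λ|⁻⁴` off a ball is controlled by the reciprocal of the dual measure of
that ball. This is a downward induction on the radius `s`: the shell of inner radius `s`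
contributes at most a multiple of `1 / σ(B(z, 2s))`, and reverse doubling turns the bound for `2s`
into one for `s` with the same constant. No self-improvement of the weight is needed. -/
lemma exists_lintegral_compl_ball_mul_le (h : IsA2Pair μ σ C) :
    ∃ A : ℝ, 0 < A ∧ ∀ z ∈ disk, ∀ s : ℝ, 0 < s →
      (∫⁻ w in disk \ ball z s, ENNReal.ofReal ((dist w z ^ 4)⁻¹) ∂μ) * σ (ball z s)
        ≤ ENNReal.ofReal A := by
  obtain ⟨q, hq0, hq1, hq⟩ := h.exists_reverse_doubling_dual
  have hC := h.pos
  -- `A` solves `q (16 C + A) = A`, enlarged so as to cover the radii `s ≥ 1/2`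
  obtain ⟨A, hA256, hA⟩ : ∃ A : ℝ, 256 * C ≤ A ∧ q * (16 * C + A) ≤ A := by
    refine ⟨256 * C / (1 - q), ?_, ?_⟩
    · rw [le_div_iff₀ (by linarith)]; nlinarith
    · have : 256 * C / (1 - q) * (1 - q) = 256 * C := div_mul_cancel₀ _ (by linarith)
      nlinarith
  have hbound : ∀ z ∈ disk, ∀ s : ℝ, 0 < s → ∀ E : Set ℂ, MeasurableSet E →
      (∫⁻ w in E \ ball z s, ENNReal.ofReal ((dist w z ^ 4)⁻¹) ∂μ)
        ≤ ENNReal.ofReal ((s ^ 4)⁻¹) * μ E := by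
    intro z hz s hs E hE
    calc _ ≤ ∫⁻ w in E \ ball z s, ENNReal.ofReal ((s ^ 4)⁻¹) ∂μ := by
          refine setLIntegral_mono' (hE.diff measurableSet_ball) fun w hw => ?_
          have : s ≤ dist w z := by simpa using hw.2
          gcongr
      _ ≤ _ := by
          rw [setLIntegral_const]
          gcongr
          exact Set.sdiff_subset
  refine ⟨A, by linarith, fun z hz => ?_⟩
  suffices ∀ n : ℕ, ∀ s : ℝ, 0 < s → (1 / 2 : ℝ) ^ (n + 1) ≤ s →
      (∫⁻ w in disk \ ball z s, ENNReal.ofReal ((dist w z ^ 4)⁻¹) ∂μ) * σ (ball z s)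
        ≤ ENNReal.ofReal A by
    intro s hs
    obtain ⟨n, hn⟩ := exists_pow_lt_of_lt_one hs (show (1 / 2 : ℝ) < 1 by norm_num)
    refine this n s hs (le_trans ?_ hn.le)
    rw [pow_succ]
    have : (0 : ℝ) < (1 / 2) ^ n := by positivity
    linarith
  -- the radii `s ≥ 1/2`
  have hlarge : ∀ s : ℝ, 1 / 2 ≤ s →
      (∫⁻ w in disk \ ball z s, ENNReal.ofReal ((dist w z ^ 4)⁻¹) ∂μ) * σ (ball z s)
        ≤ ENNReal.ofReal A := by
    intro s hs
    have hs0 : 0 < s := by linarith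
    rcases le_or_gt 2 s with h2 | h2
    · have : disk \ ball z s = ∅ := by
        rw [Set.sdiff_eq_empty]
        apply ball_subset_ball'
        rw [mem_disk] at hz
        rw [dist_zero_left]
        linarith
      simp [this]
    have hsub : disk ⊆ ball z 2 := by
      apply ball_subset_ball'
      rw [mem_disk] at hz
      rw [dist_zero_left]
      linarith
    calc _ ≤ ENNReal.ofReal ((s ^ 4)⁻¹) * μ disk * σ (ball z s) := by
          gcongr; exact hbound z hz s hs0 disk measurableSet_disk
      _ ≤ ENNReal.ofReal (((1 / 2) ^ 4)⁻¹) * (μ (ball z 2) * σ (ball z 2)) := by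
          rw [mul_assoc]
          gcongr
      _ ≤ ENNReal.ofReal (((1 / 2) ^ 4)⁻¹) * ENNReal.ofReal (C * 2 ^ 4) := by
          gcongr; exact h.mul_le z hz 2 two_pos
      _ ≤ _ := by
          rw [← ENNReal.ofReal_mul (by positivity)]
          apply ENNReal.ofReal_le_ofReal
          linarith
  intro n
  induction n with
  | zero => intro s hs hs'; exact hlarge s (by simpa using hs')
  | succ n ih =>
    intro s hs hs'
    rcases le_or_gt (1 / 2) s with h2 | h2
    · exact hlarge s h2
    have hih := ih (2 * s) (by positivity) (by rw [pow_succ] at hs'; linarith)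
    have hsplit : (∫⁻ w in disk \ ball z s, ENNReal.ofReal ((dist w z ^ 4)⁻¹) ∂μ) ≤
        (∫⁻ w in ball z (2 * s) \ ball z s, ENNReal.ofReal ((dist w z ^ 4)⁻¹) ∂μ) +
        ∫⁻ w in disk \ ball z (2 * s), ENNReal.ofReal ((dist w z ^ 4)⁻¹) ∂μ := by
      refine (lintegral_mono_set ?_).trans (lintegral_union_le _ _ _)
      intro w hw
      by_cases hw2 : w ∈ ball z (2 * s)
      · exact Or.inl ⟨hw2, hw.2⟩
      · exact Or.inr ⟨hw.1, hw2⟩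
    have hshell := (hbound z hz s hs (ball z (2 * s)) measurableSet_ball)
    calc _ ≤ (ENNReal.ofReal ((s ^ 4)⁻¹) * μ (ball z (2 * s)) +
          ∫⁻ w in disk \ ball z (2 * s), ENNReal.ofReal ((dist w z ^ 4)⁻¹) ∂μ) *
          (ENNReal.ofReal q * σ (ball z (2 * s))) := by
          gcongr
          · exact hsplit.trans (by gcongr)
          · exact hq z hz s hs h2.le
      _ = ENNReal.ofReal q * (ENNReal.ofReal ((s ^ 4)⁻¹) *
          (μ (ball z (2 * s)) * σ (ball z (2 * s))) +
          (∫⁻ w in disk \ ball z (2 * s), ENNReal.ofReal ((dist w z ^ 4)⁻¹) ∂μ) *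
            σ (ball z (2 * s))) := by ring
      _ ≤ ENNReal.ofReal q * (ENNReal.ofReal ((s ^ 4)⁻¹) * ENNReal.ofReal (C * (2 * s) ^ 4) +
          ENNReal.ofReal A) := by
          gcongr
          exact h.mul_le z hz _ (by positivity)
      _ = ENNReal.ofReal (q * (16 * C + A)) := by
          rw [← ENNReal.ofReal_mul (by positivity), ← ENNReal.ofReal_add (by positivity)
            (by linarith), ← ENNReal.ofReal_mul hq0]
          congr 3
          field_simp
          ring
      _ ≤ _ := ENNReal.ofReal_le_ofReal hA

end IsA2Pair

/-! ### The weighted norm of the unweighted reproducing kernel -/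

lemma norm_one_sub_conj_mul_comm (z w : ℂ) : ‖1 - conj w * z‖ = ‖1 - conj z * w‖ := by
  rw [← Complex.norm_conj]
  simp [mul_comm]

lemma one_sub_norm_le {z w : ℂ} (hw : w ∈ disk) : 1 - ‖z‖ ≤ ‖1 - conj z * w‖ := by
  rw [mem_disk] at hw
  have h1 : ‖(1 : ℂ)‖ - ‖conj z * w‖ ≤ ‖1 - conj z * w‖ := norm_sub_norm_le _ _
  rw [norm_one, norm_mul, Complex.norm_conj] at h1
  nlinarith [norm_nonneg z]

lemma dist_le_norm_one_sub {z w : ℂ} (hz : z ∈ disk) (hw : w ∈ disk) :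
    dist w z ≤ ‖1 - conj z * w‖ := by
  rw [mem_disk] at hz hw
  have key : ‖1 - conj z * w‖ ^ 2 - ‖w - z‖ ^ 2 = (1 - ‖z‖ ^ 2) * (1 - ‖w‖ ^ 2) := by
    simp only [Complex.sq_norm, Complex.normSq_apply, Complex.sub_re, Complex.sub_im,
      Complex.mul_re, Complex.mul_im, Complex.conj_re, Complex.conj_im, Complex.one_re,
      Complex.one_im]
    ring
  rw [dist_eq_norm]
  refine abs_le_of_sq_le_sq' ?_ (norm_nonneg _) |>.2
  have : 0 ≤ (1 - ‖z‖ ^ 2) * (1 - ‖w‖ ^ 2) :=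
    mul_nonneg (by nlinarith [norm_nonneg z]) (by nlinarith [norm_nonneg w])
  linarith

lemma norm_one_sub_pos {z w : ℂ} (hz : z ∈ disk) (hw : w ∈ disk) : 0 < ‖1 - conj z * w‖ := by
  have := one_sub_norm_le (z := z) hw
  rw [mem_disk] at hz
  linarith

lemma norm_R_le {z w : ℂ} (hz : z ∈ disk) (hw : w ∈ disk) :
    ‖R z w‖ ≤ 6 / ‖1 - conj z * w‖ ^ 2 := by
  have hp := norm_one_sub_pos hz hw
  have h2 : ‖1 - conj z * w‖ ≤ 2 := by
    rw [mem_disk] at hz hw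
    have h1 : ‖1 - conj z * w‖ ≤ ‖(1 : ℂ)‖ + ‖conj z * w‖ := norm_sub_le _ _
    rw [norm_one, norm_mul, Complex.norm_conj] at h1
    nlinarith [norm_nonneg z, norm_nonneg w]
  have h4 : 1 ≤ 4 / ‖1 - conj z * w‖ ^ 2 := by
    rw [le_div_iff₀ (by positivity)]; nlinarith
  calc ‖R z w‖ ≤ ‖1 / (1 - conj w * z) ^ 2‖ + ‖1 / (1 - conj z * w) ^ 2‖ + ‖(1 : ℂ)‖ :=
        (norm_sub_le _ _).trans (by gcongr; exact norm_add_le _ _)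
    _ = 2 / ‖1 - conj z * w‖ ^ 2 + 1 := by
        rw [norm_div, norm_div, norm_pow, norm_pow, norm_one, norm_one_sub_conj_mul_comm z w]
        ring
    _ ≤ 2 / ‖1 - conj z * w‖ ^ 2 + 4 / ‖1 - conj z * w‖ ^ 2 := by gcongr
    _ = _ := by ring

lemma norm_R_le_of_mem {z w : ℂ} (hz : z ∈ disk) (hw : w ∈ disk) :
    ‖R z w‖ ≤ 6 / (1 - ‖z‖) ^ 2 := by
  have h1 : 0 < 1 - ‖z‖ := by rw [mem_disk] at hz; linarith
  refine (norm_R_le hz hw).trans ?_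
  gcongr
  exact one_sub_norm_le hw

lemma enorm_sq_eq_ofReal (x : ℂ) : ‖x‖ₑ ^ 2 = ENNReal.ofReal (‖x‖ ^ 2) := by
  rw [← ofReal_norm, ENNReal.ofReal_pow (norm_nonneg _)]

/-- The upper bound for the weighted norm of `R_z`: up to constants, `|R_z(w)|` is at most
`|1 - z̄w|⁻²`, and `|1 - z̄w|` dominates both `1 - |z|` and `|w - z|`. -/
lemma IsA2Pair.exists_lintegral_R_le {μ σ : Measure ℂ} {C : ℝ} (h : IsA2Pair μ σ C) :
    ∃ A : ℝ, 0 < A ∧ ∀ z ∈ disk, ∫⁻ w, ‖R z w‖ₑ ^ 2 ∂μ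
      ≤ ENNReal.ofReal (A / (1 - ‖z‖) ^ 4) * μ (ball z (1 - ‖z‖)) := by
  obtain ⟨A, hA, hJ⟩ := h.exists_lintegral_compl_ball_mul_le
  refine ⟨36 * (1 + A), by positivity, fun z hz => ?_⟩
  have hδ : 0 < 1 - ‖z‖ := by rw [mem_disk] at hz; linarith
  set δ := 1 - ‖z‖
  have hsub : ball z δ ⊆ disk := ball_subset_disk le_rfl
  set J := ∫⁻ w in disk \ ball z δ, ENNReal.ofReal ((dist w z ^ 4)⁻¹) ∂μ with hJdef
  have hJ' : J ≤ ENNReal.ofReal (A / δ ^ 4) * μ (ball z δ) := by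
    have h1 : ENNReal.ofReal (δ ^ 4) * J ≤
        ENNReal.ofReal (δ ^ 4) * (ENNReal.ofReal (A / δ ^ 4) * μ (ball z δ)) := by
      calc _ ≤ μ (ball z δ) * σ (ball z δ) * J := by gcongr; exact h.pow_four_le hδ.le hsub
        _ = μ (ball z δ) * (J * σ (ball z δ)) := by ring
        _ ≤ μ (ball z δ) * ENNReal.ofReal A := by gcongr; exact hJ z hz δ hδ
        _ = _ := by
          rw [← mul_assoc, ← ENNReal.ofReal_mul (by positivity), mul_div_cancel₀ _ (by positivity),
            mul_comm]
    have h0 : ENNReal.ofReal (δ ^ 4) ≠ 0 := by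
      simp only [ne_eq, ENNReal.ofReal_eq_zero, not_le]; positivity
    rwa [ENNReal.mul_le_mul_iff_right h0 ENNReal.ofReal_ne_top] at h1
  have hnear : ∫⁻ w in ball z δ, ‖R z w‖ₑ ^ 2 ∂μ ≤ ENNReal.ofReal (36 / δ ^ 4) * μ (ball z δ) := by
    rw [← setLIntegral_const]
    refine setLIntegral_mono' measurableSet_ball fun w hw => ?_
    rw [enorm_sq_eq_ofReal]
    apply ENNReal.ofReal_le_ofReal
    calc ‖R z w‖ ^ 2 ≤ (6 / δ ^ 2) ^ 2 := by gcongr; exact norm_R_le_of_mem hz (hsub hw)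
      _ = 36 / δ ^ 4 := by rw [div_pow, ← pow_mul]; norm_num
  have hfar : ∫⁻ w in disk \ ball z δ, ‖R z w‖ₑ ^ 2 ∂μ ≤ ENNReal.ofReal 36 * J := by
    rw [hJdef, ← lintegral_const_mul' _ _ ENNReal.ofReal_ne_top]
    refine setLIntegral_mono' (measurableSet_disk.diff measurableSet_ball) fun w hw => ?_
    rw [enorm_sq_eq_ofReal, ← ENNReal.ofReal_mul (by norm_num)]
    apply ENNReal.ofReal_le_ofReal
    have hd : 0 < dist w z := hδ.trans_le (by simpa using hw.2)
    calc ‖R z w‖ ^ 2 ≤ (6 / dist w z ^ 2) ^ 2 := by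
          gcongr
          refine (norm_R_le hz hw.1).trans ?_
          gcongr
          exact dist_le_norm_one_sub hz hw.1
      _ = _ := by ring
  calc ∫⁻ w, ‖R z w‖ₑ ^ 2 ∂μ = ∫⁻ w in disk, ‖R z w‖ₑ ^ 2 ∂μ := by
        rw [Measure.restrict_eq_self_of_ae_mem (ae_mem_disk h.compl_disk)]
    _ ≤ ∫⁻ w in ball z δ ∪ disk \ ball z δ, ‖R z w‖ₑ ^ 2 ∂μ :=
        lintegral_mono_set (by rw [Set.union_sdiff_self]; exact Set.subset_union_right)
    _ ≤ _ := lintegral_union_le _ _ _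
    _ ≤ ENNReal.ofReal (36 / δ ^ 4) * μ (ball z δ) +
        ENNReal.ofReal 36 * (ENNReal.ofReal (A / δ ^ 4) * μ (ball z δ)) := by
        gcongr; exact hfar.trans (by gcongr)
    _ = _ := by
        rw [← mul_assoc, ← ENNReal.ofReal_mul (by norm_num), ← add_mul,
          ← ENNReal.ofReal_add (by positivity) (by positivity)]
        congr 2
        ring

/-! ### The weight measures of a Muckenhoupt weight -/

lemma lintegral_weightMeasure {u : ℂ → ℝ} (hu : AEMeasurable u dA) {f : ℂ → ℝ≥0∞}
    (hf : AEMeasurable f dA) (E : Set ℂ) (hE : MeasurableSet E) :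
    ∫⁻ z in E, f z ∂weightMeasure u = ∫⁻ z in E, ENNReal.ofReal (u z) * f z ∂dA := by
  rw [weightMeasure, restrict_withDensity hE,
    lintegral_withDensity_eq_lintegral_mul₀ hu.ennreal_ofReal.restrict hf.restrict]
  rfl

lemma weightMeasure_apply {u : ℂ → ℝ} {E : Set ℂ} (hE : MeasurableSet E) :
    weightMeasure u E = ∫⁻ z in E, ENNReal.ofReal (u z) ∂dA :=
  withDensity_apply _ hE

lemma weightMeasure_absolutelyContinuous (u : ℂ → ℝ) : weightMeasure u ≪ dA :=
  withDensity_absolutelyContinuous _ _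

lemma IsA2Weight.absolutelyContinuous {ω : ℂ → ℝ} (hω : IsA2Weight ω) :
    dA ≪ weightMeasure ω := by
  refine withDensity_absolutelyContinuous' hω.integrable.aemeasurable.ennreal_ofReal ?_
  filter_upwards [hω.pos] with z hz
  simpa using hz

/-- The Cauchy–Schwarz inequality `(∫ f dA)² ≤ ∫ f² ω dA · ∫ ω⁻¹ dA`. -/
lemma sq_setLIntegral_dA_le {ω : ℂ → ℝ} (hm : AEMeasurable ω dA) (hpos : ∀ᵐ z ∂dA, 0 < ω z)
    {E : Set ℂ} (hE : MeasurableSet E) {f : ℂ → ℝ≥0∞} (hf : AEMeasurable f dA) :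
    (∫⁻ z in E, f z ∂dA) ^ 2 ≤
      (∫⁻ z in E, f z ^ 2 ∂weightMeasure ω) * weightMeasure (fun z => (ω z)⁻¹) E := by
  rw [lintegral_weightMeasure hm (hf.pow_const 2) E hE, weightMeasure_apply hE]
  set U : ℂ → ℝ≥0∞ := fun z => ENNReal.ofReal (ω z)
  have hU : AEMeasurable U dA := hm.ennreal_ofReal
  have hold := ENNReal.lintegral_mul_le_Lp_mul_Lq (dA.restrict E) Real.HolderConjugate.two_two
    (f := fun z => f z * U z ^ (1 / 2 : ℝ)) (g := fun z => (U z ^ (1 / 2 : ℝ))⁻¹)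
    (hf.mul (hU.pow_const _)).restrict (hU.pow_const _).inv.restrict
  have hpos' : ∀ᵐ z ∂dA.restrict E, 0 < ω z := ae_restrict_of_ae hpos
  have hsq : ∀ x : ℝ≥0∞, (x ^ (1 / 2 : ℝ)) ^ 2 = x := fun x => by
    rw [← ENNReal.rpow_natCast, ← ENNReal.rpow_mul]; norm_num
  have e1 : ∫⁻ z in E, f z ∂dA = ∫⁻ z in E, ((fun z => f z * U z ^ (1 / 2 : ℝ)) *
      fun z => (U z ^ (1 / 2 : ℝ))⁻¹) z ∂dA := by
    refine lintegral_congr_ae ?_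
    filter_upwards [hpos'] with z hz
    have h0 : U z ^ (1 / 2 : ℝ) ≠ 0 := by simp [U, hz]
    have h1 : U z ^ (1 / 2 : ℝ) ≠ ∞ := by simp [U]
    simp only [Pi.mul_apply]
    rw [mul_assoc, ENNReal.mul_inv_cancel h0 h1, mul_one]
  have e2 : ∫⁻ z in E, ENNReal.ofReal (ω z) * f z ^ 2 ∂dA =
      ∫⁻ z in E, (f z * U z ^ (1 / 2 : ℝ)) ^ (2 : ℝ) ∂dA := by
    refine lintegral_congr fun z => ?_
    rw [ENNReal.rpow_two, mul_pow, hsq, mul_comm]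
  have e3 : ∫⁻ z in E, ENNReal.ofReal ((ω z)⁻¹) ∂dA =
      ∫⁻ z in E, ((U z ^ (1 / 2 : ℝ))⁻¹) ^ (2 : ℝ) ∂dA := by
    refine lintegral_congr_ae ?_
    filter_upwards [hpos'] with z hz
    rw [ENNReal.rpow_two, ← ENNReal.inv_pow, hsq, ENNReal.ofReal_inv_of_pos hz]
  rw [e1, e2, e3]
  refine (pow_le_pow_left₀ zero_le hold 2).trans ?_
  rw [mul_pow, hsq, hsq]

lemma IsA2Weight.exists_isA2Pair {ω : ℂ → ℝ} (hω : IsA2Weight ω) :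
    ∃ C, IsA2Pair (weightMeasure ω) (weightMeasure fun z => (ω z)⁻¹) C := by
  obtain ⟨C, hC⟩ := hω.bound
  set μ := weightMeasure ω
  set σ := weightMeasure fun z => (ω z)⁻¹
  have hcs : ∀ E, MeasurableSet E → ∀ f : ℂ → ℝ≥0∞, AEMeasurable f dA →
      (∫⁻ z in E, f z ∂dA) ^ 2 ≤ (∫⁻ z in E, f z ^ 2 ∂μ) * σ E := fun E hE f hf =>
    sq_setLIntegral_dA_le hω.integrable.aemeasurable hω.pos hE hf
  have hμc : μ diskᶜ = 0 := weightMeasure_absolutelyContinuous ω dA_compl_disk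
  have hσc : σ diskᶜ = 0 := weightMeasure_absolutelyContinuous _ dA_compl_disk
  have huniv : ∀ ρ : Measure ℂ, ρ diskᶜ = 0 → ρ Set.univ = ρ disk := fun ρ h => by
    rw [← measure_add_measure_compl measurableSet_disk, h, add_zero]
  have hsmall : ∀ a ∈ disk, ∀ r : ℝ, 0 < r → r < 1 →
      μ (ball a r) * σ (ball a r) ≤ C * ENNReal.ofReal (r ^ 4) := by
    intro a ha r hr hr1
    have := hC a ha r hr hr1
    rw [← weightMeasure_apply measurableSet_ball, ← weightMeasure_apply measurableSet_ball] at this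
    refine this.trans ?_
    gcongr
    calc _ ≤ ENNReal.ofReal (r ^ 2) ^ 2 := by gcongr; exact dA_ball_le a hr.le
      _ = _ := by rw [← ENNReal.ofReal_pow (by positivity)]; ring_nf
  -- the bound extends to the whole disk by exhausting it with concentric balls
  have hdisk : μ disk * σ disk ≤ C := by
    have hmono : Monotone fun n : ℕ => ball (0 : ℂ) (1 - 1 / (n + 2)) := by
      intro m n hmn
      apply ball_subset_ball
      have : (m : ℝ) ≤ n := by exact_mod_cast hmn
      gcongr
    have hU : ⋃ n : ℕ, ball (0 : ℂ) (1 - 1 / (n + 2)) = disk := by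
      ext z
      simp only [Set.mem_iUnion, mem_ball_zero_iff, mem_disk]
      constructor
      · rintro ⟨n, hn⟩
        have : (0 : ℝ) < 1 / (n + 2) := by positivity
        linarith
      · intro hz
        obtain ⟨n, hn⟩ := exists_nat_one_div_lt (sub_pos.2 hz)
        refine ⟨n, ?_⟩
        have : (1 : ℝ) / (n + 2) ≤ 1 / (n + 1) := by gcongr; norm_num
        linarith
    rw [← hU, hmono.measure_iUnion, hmono.measure_iUnion, ENNReal.iSup_mul]
    refine iSup_le fun i => ?_
    rw [ENNReal.mul_iSup]
    refine iSup_le fun j => ?_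
    set n := max i j
    refine (mul_le_mul' (measure_mono (hmono (le_max_left i j)))
      (measure_mono (hmono (le_max_right i j)))).trans ?_
    have hn : (0 : ℝ) < 1 / (n + 2) := by positivity
    have hn1 : (1 : ℝ) / (n + 2) < 1 := by
      rw [div_lt_one (by positivity)]
      linarith [Nat.cast_nonneg (α := ℝ) n]
    refine (hsmall 0 (by simp [mem_disk]) _ (by linarith) (by linarith)).trans ?_
    calc _ ≤ (C : ℝ≥0∞) * ENNReal.ofReal (1 ^ 4) := by
          gcongr
          linarith
      _ = C := by simp
  have hone : 1 ≤ μ disk * σ disk := by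
    have := hcs disk measurableSet_disk (fun _ => 1) aemeasurable_const
    simpa [dA_disk] using this
  have hμfin : IsFiniteMeasure μ := by
    refine ⟨?_⟩
    rw [huniv μ hμc]
    refine lt_top_iff_ne_top.2 fun ht => ?_
    rw [ht] at hdisk hone
    by_cases h0 : σ disk = 0
    · simp [h0] at hone
    · simp [ENNReal.top_mul h0] at hdisk
  have hσfin : IsFiniteMeasure σ := by
    refine ⟨?_⟩
    rw [huniv σ hσc]
    refine lt_top_iff_ne_top.2 fun ht => ?_
    rw [ht] at hdisk hone
    by_cases h0 : μ disk = 0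
    · simp [h0] at hone
    · simp [ENNReal.mul_top h0] at hdisk
  refine ⟨C + 1, by positivity, hμfin, hσfin, hμc, hcs, fun a ha r hr => ?_⟩
  have hCr : ENNReal.ofReal ((C + 1) * r ^ 4) = (C + 1) * ENNReal.ofReal (r ^ 4) := by
    rw [ENNReal.ofReal_mul (by positivity), ENNReal.ofReal_add (by positivity) zero_le_one]
    simp
  rw [hCr]
  rcases lt_or_ge r 1 with h1 | h1
  · refine (hsmall a ha r hr h1).trans ?_
    gcongr
    exact le_self_add
  · calc _ ≤ μ Set.univ * σ Set.univ := by gcongr <;> exact Set.subset_univ _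
      _ ≤ C := by rw [huniv μ hμc, huniv σ hσc]; exact hdisk
      _ ≤ (C + 1) * 1 := by rw [mul_one]; exact le_self_add
      _ ≤ _ := by
        gcongr
        rw [← ENNReal.ofReal_one]
        exact ENNReal.ofReal_le_ofReal (one_le_pow₀ h1)

section

open InnerProductSpace Complex

/-! ### Estimates for harmonic functions -/

/-- Write the real harmonic function as the real part of a holomorphic one and apply the
Borel–Carathéodory theorem. -/
lemma abs_sub_le_of_harmonic {f : ℂ → ℝ} {c : ℂ} {ρ M : ℝ} (hf : HarmonicOnNhd f (ball c ρ))
    (hM : 0 < M) (hb : ∀ z ∈ ball c ρ, |f z| ≤ M) {w : ℂ} (hw : w ∈ ball c ρ) :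
    |f w - f c| ≤ 4 * M * ‖w - c‖ / (ρ - ‖w - c‖) := by
  obtain ⟨F, hF, hFf⟩ := hf.exists_analyticOnNhd_ball_re_eq
  have hρ : 0 < ρ := pos_of_mem_ball hw
  have hc : c ∈ ball c ρ := mem_ball_self hρ
  have hmaps : Set.MapsTo (fun z : ℂ => z + c) (ball 0 ρ) (ball c ρ) := by
    intro z hz
    simpa [mem_ball_iff_norm] using hz
  have hG := borelCaratheodory_zero (f := fun z => F (z + c) - F c) (M := 2 * M) (R := ρ)
    (z := w - c) (by positivity)
    ((hF.differentiableOn.comp (by fun_prop) hmaps).sub_const _) ?_ hρ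
    (by simpa [← mem_ball_iff_norm] using hw) (by simp)
  · have h1 : f w - f c = (F w - F c).re := by
      rw [sub_re]
      exact congrArg₂ _ (hFf hw).symm (hFf hc).symm
    rw [h1]
    refine (abs_re_le_norm _).trans ?_
    rw [sub_add_cancel] at hG
    exact hG.trans_eq (by ring)
  · intro z hz
    have e1 : (F (z + c)).re = f (z + c) := hFf (hmaps hz)
    have e2 : (F c).re = f c := hFf hc
    simp only [Set.mem_ofPred_eq, sub_re, e1, e2]
    linarith [le_abs_self (f (z + c)), neg_abs_le (f c), hb _ (hmaps hz), hb c hc]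

/-- A bounded harmonic function varies little near the centre of a ball. -/
lemma norm_sub_le_of_harmonic {f : ℂ → ℂ} {c : ℂ} {ρ M : ℝ} (hf : HarmonicOnNhd f (ball c ρ))
    (hM : 0 < M) (hb : ∀ z ∈ ball c ρ, ‖f z‖ ≤ M) {w : ℂ} (hw : w ∈ ball c ρ) :
    ‖f w - f c‖ ≤ 8 * M * ‖w - c‖ / (ρ - ‖w - c‖) := by
  have h1 := abs_sub_le_of_harmonic (hf.comp_CLM reCLM) hM
    (fun z hz => (abs_re_le_norm _).trans (hb z hz)) hw
  have h2 := abs_sub_le_of_harmonic (hf.comp_CLM imCLM) hM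
    (fun z hz => (abs_im_le_norm _).trans (hb z hz)) hw
  calc ‖f w - f c‖ ≤ |(f w - f c).re| + |(f w - f c).im| := norm_le_abs_re_add_abs_im _
    _ ≤ 4 * M * ‖w - c‖ / (ρ - ‖w - c‖) + 4 * M * ‖w - c‖ / (ρ - ‖w - c‖) := by
        gcongr
        · simpa using h1
        · simpa using h2
    _ = _ := by ring

lemma norm_sub_le_of_harmonic_disk {f : ℂ → ℂ} (hf : HarmonicOnNhd f disk) {z : ℂ} (hz : z ∈ disk)
    {M : ℝ} (hM : 0 < M) (hb : ∀ w ∈ ball z ((1 - ‖z‖) / 2), ‖f w‖ ≤ M) {w : ℂ}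
    (hw : ‖w - z‖ ≤ (1 - ‖z‖) / 4) :
    ‖f w - f z‖ ≤ 32 * M * (‖w - z‖ / (1 - ‖z‖)) := by
  have hδ : 0 < 1 - ‖z‖ := by rw [mem_disk] at hz; linarith
  have h := norm_sub_le_of_harmonic (ρ := (1 - ‖z‖) / 2)
    (hf.mono (ball_subset_disk (w := z) (by linarith))) hM hb (w := w)
    (by rw [mem_ball_iff_norm]; linarith)
  calc _ ≤ _ := h
    _ ≤ 8 * M * ‖w - z‖ / ((1 - ‖z‖) / 4) := by gcongr; linarith
    _ = _ := by field_simp; ring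

/-- The Poisson integral formula passes to a uniform limit, and a Poisson integral is the real part
of a holomorphic Herglotz integral. -/
lemma harmonicOnNhd_of_tendstoLocallyUniformlyOn_real {f : ℕ → ℂ → ℝ} {g : ℂ → ℝ} {U : Set ℂ}
    (hU : IsOpen U) (hf : ∀ n, HarmonicOnNhd (f n) U)
    (hfg : TendstoLocallyUniformlyOn f g Filter.atTop U) : HarmonicOnNhd g U := by
  intro x hx
  obtain ⟨r, hr, hrU⟩ := Metric.nhds_basis_closedBall.mem_iff.1 (hU.mem_nhds hx)
  have hunif : TendstoUniformlyOn f g Filter.atTop (closedBall x r) :=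
    (tendstoLocallyUniformlyOn_iff_tendstoUniformlyOn_of_compact (isCompact_closedBall x r)).1
      (hfg.mono hrU)
  have hgc : ContinuousOn g (closedBall x r) :=
    hunif.continuousOn (Filter.Frequently.of_forall fun n => (hf n).continuousOn.mono hrU)
  have hmaps : Set.MapsTo (fun z : ℂ => z + x) (sphere 0 |r|) (closedBall x r) := by
    intro z hz
    rw [abs_of_pos hr] at hz
    simpa [mem_closedBall, dist_eq_norm] using (mem_sphere_zero_iff_norm.1 hz).le
  have hci : ∀ u : ℂ → ℝ, ContinuousOn u (closedBall x r) →
      ContinuousOn (fun z => u (z + x)) (sphere 0 |r|) := fun u hu =>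
    hu.comp (by fun_prop) hmaps
  set G : ℂ → ℂ := fun w =>
    Real.circleAverage (fun ζ ↦ herglotzRieszKernel 0 w ζ • (g (ζ + x) : ℂ)) 0 r
  have hG : AnalyticOnNhd ℂ G (ball 0 r) :=
    analyticOnNhd_circleAverage_herglotzRieszKernel_smul
      ((continuous_ofReal.comp_continuousOn (hci g hgc)).circleIntegrable')
  have hgG : ∀ w ∈ ball (0 : ℂ) r, g (w + x) = (G w).re := by
    intro w hw
    rw [re_circleAverage_herglotzRieszKernel_smul (g := fun ζ => g (ζ + x))
      ((hci g hgc).circleIntegrable') hw]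
    have hwx : w + x ∈ ball x r := by simpa [mem_ball_iff_norm] using hw
    set P : ℂ → ℝ := Complex.re ∘ herglotzRieszKernel 0 w
    have hPc : ContinuousOn P (sphere 0 |r|) :=
      continuous_re.comp_continuousOn (continuousOn_herglotzRieszKernel_sphere hw)
    have hf' : ∀ n, f n (w + x) = Real.circleAverage (P • fun ζ => f n (ζ + x)) 0 r := by
      intro n
      rw [← ((hf n).mono hrU).circleAverage_re_herglotzRieszKernel_smul hwx,
        ← Real.circleAverage_map_add_const]
      congr 1
      ext ζ
      simp [P, herglotzRieszKernel_add_const]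
    have hlim : Filter.Tendsto (fun n => f n (w + x)) Filter.atTop
        (nhds (Real.circleAverage (P • fun ζ => g (ζ + x)) 0 r)) := by
      obtain ⟨Q, hQ⟩ := (isCompact_sphere (0 : ℂ) |r|).exists_bound_of_continuousOn hPc
      have hQ0 : 0 ≤ Q := by
        have := hQ (r : ℂ) (by simp)
        exact (norm_nonneg _).trans this
      rw [Metric.tendsto_atTop]
      intro ε hε
      obtain ⟨N, hN⟩ := Filter.eventually_atTop.1
        (Metric.tendstoUniformlyOn_iff.1 hunif (ε / (Q + 1)) (by positivity))
      refine ⟨N, fun n hn => ?_⟩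
      rw [hf' n, Real.dist_eq, ← Real.circleAverage_sub
        (hPc.smul (hci _ ((hf n).continuousOn.mono hrU))).circleIntegrable'
        (hPc.smul (hci _ hgc)).circleIntegrable']
      have hle : Real.circleAverage |(P • fun ζ => f n (ζ + x)) - P • fun ζ => g (ζ + x)| 0 r
          ≤ Q * (ε / (Q + 1)) := by
        refine Real.circleAverage_mono_on_of_le_circle ?_ fun ζ hζ => ?_
        · exact (((hPc.smul (hci _ ((hf n).continuousOn.mono hrU))).sub
            (hPc.smul (hci _ hgc))).abs).circleIntegrable'
        · have h1 := hQ ζ hζ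
          have h2 := (hN n hn _ (hmaps hζ)).le
          rw [dist_comm, Real.dist_eq] at h2
          have e : |(P • fun ζ => f n (ζ + x)) - P • fun ζ => g (ζ + x)| ζ =
              |P ζ| * |f n (ζ + x) - g (ζ + x)| := by
            rw [← abs_mul, mul_sub]
            rfl
          rw [e]
          exact mul_le_mul h1 h2 (abs_nonneg _) hQ0
      refine (Real.abs_circleAverage_le_circleAverage_abs.trans hle).trans_lt ?_
      rw [mul_div_assoc', div_lt_iff₀ (by positivity)]
      nlinarith
    exact tendsto_nhds_unique (hunif.tendsto_at (ball_subset_closedBall hwx)) hlim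
  have hcx : x ∈ ball x r := mem_ball_self hr
  have hF : AnalyticAt ℂ (fun z => G (z - x)) x := by
    have : AnalyticAt ℂ G (x - x) := by rw [sub_self]; exact hG 0 (mem_ball_self hr)
    exact AnalyticAt.comp_of_eq (f := fun z => z - x) this (by fun_prop) rfl
  refine (harmonicAt_congr_nhds ?_).1 hF.harmonicAt_re
  filter_upwards [isOpen_ball.mem_nhds hcx] with z hz
  have := hgG (z - x) (by simpa [← mem_ball_iff_norm] using hz)
  rw [sub_add_cancel] at this
  exact this.symm

lemma harmonicOnNhd_of_tendstoLocallyUniformlyOn {f : ℕ → ℂ → ℂ} {g : ℂ → ℂ} {U : Set ℂ}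
    (hU : IsOpen U) (hf : ∀ n, HarmonicOnNhd (f n) U)
    (hfg : TendstoLocallyUniformlyOn f g Filter.atTop U) : HarmonicOnNhd g U := by
  have hL : ∀ l : ℂ →L[ℝ] ℝ, HarmonicOnNhd (l ∘ g) U := fun l =>
    harmonicOnNhd_of_tendstoLocallyUniformlyOn_real hU (fun n => (hf n).comp_CLM l)
      (l.uniformContinuous.comp_tendstoLocallyUniformlyOn hfg)
  have h := ((hL reCLM).comp_CLM ofRealCLM).add
    ((hL imCLM).comp_CLM ((I : ℂ) • ofRealCLM))
  convert h using 1
  ext z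
  simp [mul_comm I, re_add_im]

/-- The sub-mean value inequality for the modulus of a harmonic function, over balls: integrate the
mean value property over circles in polar coordinates. -/
lemma enorm_mul_volume_ball_le {f : ℂ → ℂ} {c : ℂ} {ρ : ℝ} (hf : HarmonicOnNhd f (ball c ρ)) :
    ‖f c‖ₑ * volume (ball c ρ) ≤ ∫⁻ z in ball c ρ, ‖f z‖ₑ := by
  set u : ℂ → ℝ≥0∞ := (ball c ρ).indicator fun z => ‖f z‖ₑ with hu
  have hum : Measurable u := by
    have h1 : Measurable ((ball c ρ).indicator f) := by
      classical
      rw [← Set.piecewise_eq_indicator]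
      exact hf.continuousOn.measurable_piecewise continuousOn_const measurableSet_ball
    convert h1.enorm using 1
    ext z
    by_cases hz : z ∈ ball c ρ <;> simp [hu, hz]
  set v : ℂ → ℝ≥0∞ := (ball c ρ).indicator fun _ => ‖f c‖ₑ with hv
  have hvm : Measurable v := measurable_const.indicator measurableSet_ball
  rw [← setLIntegral_const, ← lintegral_indicator measurableSet_ball,
    ← lintegral_indicator measurableSet_ball, ← lintegral_add_right_eq_self v c,
    ← lintegral_add_right_eq_self u c, ← Complex.lintegral_comp_polarCoord_symm,
    ← Complex.lintegral_comp_polarCoord_symm, polarCoord_target, Measure.volume_eq_prod,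
    ← Measure.prod_restrict]
  have hsm : Measurable fun p : ℝ × ℝ => Complex.polarCoord.symm p := by
    simp only [Complex.polarCoord_symm_apply]; fun_prop
  rw [lintegral_prod _ (by fun_prop), lintegral_prod _ (by fun_prop)]
  refine setLIntegral_mono' measurableSet_Ioi fun s hs => ?_
  have hs0 : 0 < s := hs
  simp only [smul_eq_mul]
  rw [lintegral_const_mul' _ _ ENNReal.ofReal_ne_top, lintegral_const_mul' _ _ ENNReal.ofReal_ne_top]
  gcongr 1
  have hcm : ∀ θ : ℝ, Complex.polarCoord.symm (s, θ) + c = circleMap c s θ := fun θ => by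
    rw [Complex.polarCoord_symm_apply, circleMap, exp_mul_I]
    push_cast
    ring
  have hmem : ∀ θ : ℝ, (circleMap c s θ ∈ ball c ρ ↔ s < ρ) := fun θ => by
    rw [mem_ball_iff_norm, circleMap_sub_center, norm_circleMap_zero, abs_of_pos hs0]
  simp only [hcm]
  by_cases hsρ : s < ρ
  · simp only [hu, hv, Set.indicator_of_mem ((hmem _).2 hsρ)]
    have hmean : Real.circleAverage f c s = f c :=
      (hf.mono (by rw [abs_of_pos hs0]; exact closedBall_subset_ball hsρ)).circleAverage_eq
    rw [Real.circleAverage_eq_integral_add (-Real.pi),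
      intervalIntegral.integral_comp_add_right (fun θ => f (circleMap c s θ))] at hmean
    rw [zero_add, show 2 * Real.pi + -Real.pi = Real.pi by ring] at hmean
    have h2 : ‖(∫ θ in (-Real.pi)..Real.pi, f (circleMap c s θ))‖ₑ ≤
        ∫⁻ θ in Set.Ioo (-Real.pi) Real.pi, ‖f (circleMap c s θ)‖ₑ := by
      rw [intervalIntegral.integral_of_le (by linarith [Real.pi_pos]), integral_Ioc_eq_integral_Ioo]
      exact enorm_integral_le_lintegral_enorm _
    refine le_trans (le_of_eq ?_) h2
    rw [← hmean, setLIntegral_const, enorm_smul, Real.volume_Ioo, mul_right_comm,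
      Real.enorm_of_nonneg (by positivity), ← ENNReal.ofReal_mul (by positivity)]
    have : (2 * Real.pi)⁻¹ * (Real.pi - -Real.pi) = 1 := by field_simp; ring
    rw [this]
    simp
  · simp [hu, hv, hmem, hsρ]

lemma harmonicOnNhd_R {z : ℂ} (hz : z ∈ disk) : HarmonicOnNhd (R z) disk := by
  intro w hw
  have hne : 1 - conj z * w ≠ 0 := norm_pos_iff.1 (norm_one_sub_pos hz hw)
  have hg : AnalyticAt ℂ (fun w => 2 * (1 / (1 - conj z * w) ^ 2) - 1) w := by
    have : (1 - conj z * w) ^ 2 ≠ 0 := pow_ne_zero 2 hne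
    fun_prop (disch := assumption)
  have h := hg.harmonicAt_re.comp_CLM ofRealCLM
  convert h using 1
  ext v
  have hc : 1 / (1 - conj v * z) ^ 2 = conj (1 / (1 - conj z * v) ^ 2) := by
    simp [mul_comm]
  simp only [R, hc, Function.comp_apply, ofRealCLM_apply, sub_re, mul_re, one_re]
  rw [add_comm, add_conj]
  simp

/-! ### Point evaluations and the weight -/

lemma aemeasurable_enorm_of_harmonic {f : ℂ → ℂ} (hf : HarmonicOnNhd f disk) :
    AEMeasurable (fun z => ‖f z‖ₑ) dA :=
  (hf.continuousOn.aemeasurable measurableSet_disk).enorm.smul_measure _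

namespace IsA2Pair

variable {μ σ : Measure ℂ} {C : ℝ}

/-- Weighted sub-mean value inequality. -/
lemma enorm_sq_mul_measure_ball_le (h : IsA2Pair μ σ C) {f : ℂ → ℂ} (hf : HarmonicOnNhd f disk)
    {w : ℂ} (hw : w ∈ disk) {t : ℝ} (ht : 0 < t) (hb : ball w t ⊆ disk) :
    ‖f w‖ₑ ^ 2 * μ (ball w t) ≤ ENNReal.ofReal C * ∫⁻ z in ball w t, ‖f z‖ₑ ^ 2 ∂μ := by
  have h1 : ‖f w‖ₑ * ENNReal.ofReal (t ^ 2) ≤ ∫⁻ z in ball w t, ‖f z‖ₑ ∂dA := by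
    rw [setLIntegral_dA_ball hb, ← inv_pi_mul_volume_ball w ht.le, mul_left_comm]
    gcongr
    exact enorm_mul_volume_ball_le (hf.mono hb)
  have hC := h.pos
  have h0 : ENNReal.ofReal (t ^ 4) ≠ 0 := by
    simp only [ne_eq, ENNReal.ofReal_eq_zero, not_le]; positivity
  rw [← ENNReal.mul_le_mul_iff_right h0 ENNReal.ofReal_ne_top]
  have e : ENNReal.ofReal (t ^ 4) = ENNReal.ofReal (t ^ 2) ^ 2 := by
    rw [← ENNReal.ofReal_pow (by positivity), ← pow_mul]
  calc ENNReal.ofReal (t ^ 4) * (‖f w‖ₑ ^ 2 * μ (ball w t))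
      = (‖f w‖ₑ * ENNReal.ofReal (t ^ 2)) ^ 2 * μ (ball w t) := by rw [e]; ring
    _ ≤ (∫⁻ z in ball w t, ‖f z‖ₑ ∂dA) ^ 2 * μ (ball w t) := by gcongr
    _ ≤ (∫⁻ z in ball w t, ‖f z‖ₑ ^ 2 ∂μ) * σ (ball w t) * μ (ball w t) := by
        gcongr
        exact h.sq_lintegral_le _ measurableSet_ball _ (aemeasurable_enorm_of_harmonic hf)
    _ = (∫⁻ z in ball w t, ‖f z‖ₑ ^ 2 ∂μ) * (μ (ball w t) * σ (ball w t)) := by ring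
    _ ≤ (∫⁻ z in ball w t, ‖f z‖ₑ ^ 2 ∂μ) * ENNReal.ofReal (C * t ^ 4) := by
        gcongr
        exact h.mul_le w hw t ht
    _ = _ := by rw [ENNReal.ofReal_mul hC.le]; ring

lemma enorm_sq_mul_measure_ball_le_of_mem (h : IsA2Pair μ σ C) {f : ℂ → ℂ}
    (hf : HarmonicOnNhd f disk) {z : ℂ} (hz : z ∈ disk) {w : ℂ}
    (hw : w ∈ ball z ((1 - ‖z‖) / 2)) :
    ‖f w‖ₑ ^ 2 * μ (ball z (1 - ‖z‖)) ≤ ENNReal.ofReal ((16 * C) ^ 2) * ∫⁻ z, ‖f z‖ₑ ^ 2 ∂μ := by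
  have hδ : 0 < 1 - ‖z‖ := by rw [mem_disk] at hz; linarith
  have hC := h.pos
  have hwz : dist w z < (1 - ‖z‖) / 2 := hw
  have hsub : ball w (1 / 4 * (1 - ‖z‖)) ⊆ ball z (1 - ‖z‖) := ball_subset_ball' (by linarith)
  have hsub' := hsub.trans (ball_subset_disk (w := z) le_rfl)
  have hd := h.doubling hz hδ (κ := 1 / 4) (by norm_num) hsub (Set.subset_inter subset_rfl hsub')
  have hwd : w ∈ disk := hsub' (mem_ball_self (by positivity))
  calc _ ≤ ‖f w‖ₑ ^ 2 *
        (ENNReal.ofReal (C / (1 / 4) ^ 4) * μ (ball w (1 / 4 * (1 - ‖z‖)))) := by gcongr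
    _ = ENNReal.ofReal (C / (1 / 4) ^ 4) *
        (‖f w‖ₑ ^ 2 * μ (ball w (1 / 4 * (1 - ‖z‖)))) := by ring
    _ ≤ ENNReal.ofReal (C / (1 / 4) ^ 4) * (ENNReal.ofReal C * ∫⁻ z, ‖f z‖ₑ ^ 2 ∂μ) := by
        refine mul_le_mul_right ((h.enorm_sq_mul_measure_ball_le hf hwd (by positivity)
          hsub').trans ?_) _
        gcongr
        exact Measure.restrict_le_self
    _ = _ := by
        rw [← mul_assoc, ← ENNReal.ofReal_mul (by positivity)]
        congr 2
        ring

end IsA2Pair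

end

open InnerProductSpace

/-! ### The weighted harmonic Bergman space -/

section

variable {ω : ℂ → ℝ}

lemma harmonicOnNhd_fn (f : L2h ω) : HarmonicOnNhd (fn f) disk := f.2.choose_spec.1

lemma coe_ae_eq_fn (f : L2h ω) : (f : Lp ℂ 2 (weightMeasure ω)) =ᵐ[weightMeasure ω] fn f :=
  f.2.choose_spec.2

lemma IsA2Weight.eqOn_of_ae_eq (hω : IsA2Weight ω) {g₁ g₂ : ℂ → ℂ} (h₁ : HarmonicOnNhd g₁ disk)
    (h₂ : HarmonicOnNhd g₂ disk) (h : g₁ =ᵐ[weightMeasure ω] g₂) : Set.EqOn g₁ g₂ disk := by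
  have h' : g₁ =ᵐ[volume.restrict disk] g₂ :=
    ((Measure.absolutelyContinuous_smul (by simp)).trans hω.absolutelyContinuous).ae_le h
  exact Measure.eqOn_open_of_ae_eq h' isOpen_disk h₁.continuousOn h₂.continuousOn

lemma IsA2Weight.fn_eqOn (hω : IsA2Weight ω) {f : L2h ω} {g : ℂ → ℂ} (hg : HarmonicOnNhd g disk)
    (h : (f : Lp ℂ 2 (weightMeasure ω)) =ᵐ[weightMeasure ω] g) : Set.EqOn (fn f) g disk :=
  hω.eqOn_of_ae_eq (harmonicOnNhd_fn f) hg ((coe_ae_eq_fn f).symm.trans h)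

lemma IsA2Weight.fn_add (hω : IsA2Weight ω) (f g : L2h ω) :
    Set.EqOn (fn (f + g)) (fn f + fn g) disk :=
  hω.fn_eqOn ((harmonicOnNhd_fn f).add (harmonicOnNhd_fn g))
    ((Lp.coeFn_add _ _).trans ((coe_ae_eq_fn f).add (coe_ae_eq_fn g)))

lemma IsA2Weight.fn_sub (hω : IsA2Weight ω) (f g : L2h ω) :
    Set.EqOn (fn (f - g)) (fn f - fn g) disk :=
  hω.fn_eqOn ((harmonicOnNhd_fn f).sub (harmonicOnNhd_fn g))
    ((Lp.coeFn_sub _ _).trans ((coe_ae_eq_fn f).sub (coe_ae_eq_fn g)))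

lemma IsA2Weight.fn_smul (hω : IsA2Weight ω) (c : ℂ) (f : L2h ω) :
    Set.EqOn (fn (c • f)) (c • fn f) disk := by
  refine hω.fn_eqOn (fun z hz => ?_) ((Lp.coeFn_smul _ _).trans ((coe_ae_eq_fn f).const_smul c))
  exact (harmonicOnNhd_fn f z hz).comp_CLM (c • ContinuousLinearMap.id ℝ ℂ)

lemma enorm_sq_eq_lintegral {α : Type*} [MeasurableSpace α] {μ : Measure α} (F : Lp ℂ 2 μ)
    {g : α → ℂ} (h : F =ᵐ[μ] g) : ‖F‖ₑ ^ 2 = ∫⁻ w, ‖g w‖ₑ ^ 2 ∂μ := by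
  have := eLpNorm_nnreal_pow_eq_lintegral (f := F) (μ := μ) (p := 2) (by norm_num)
  rw [Lp.enorm_def]
  simp only [NNReal.coe_ofNat, ENNReal.rpow_ofNat, ENNReal.coe_ofNat] at this
  rw [this]
  refine lintegral_congr_ae ?_
  filter_upwards [h] with w hw
  rw [hw]

lemma L2h_enorm_sq (f : L2h ω) : ‖f‖ₑ ^ 2 = ∫⁻ w, ‖fn f w‖ₑ ^ 2 ∂weightMeasure ω :=
  enorm_sq_eq_lintegral (f : Lp ℂ 2 (weightMeasure ω)) (coe_ae_eq_fn f)

/-- A square integrable harmonic function is an element of `L²_h(ω)`. -/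
lemma IsA2Weight.exists_fn_eqOn (hω : IsA2Weight ω) {g : ℂ → ℂ} (hg : HarmonicOnNhd g disk)
    (h : MemLp g 2 (weightMeasure ω)) : ∃ f : L2h ω, Set.EqOn (fn f) g disk :=
  ⟨⟨h.toLp g, g, hg, h.coeFn_toLp⟩, hω.fn_eqOn hg h.coeFn_toLp⟩

variable {C : ℝ}

/-- Point evaluations are bounded, uniformly near each point of the disk. -/
lemma IsA2Pair.norm_fn_sq_le {σ : Measure ℂ} (h : IsA2Pair (weightMeasure ω) σ C) (f : L2h ω)
    {z : ℂ} (hz : z ∈ disk) {w : ℂ} (hw : w ∈ ball z ((1 - ‖z‖) / 2)) :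
    ‖fn f w‖ ^ 2 * (weightMeasure ω).real (ball z (1 - ‖z‖)) ≤ (16 * C * ‖f‖) ^ 2 := by
  have := h.finite
  have h1 := h.enorm_sq_mul_measure_ball_le_of_mem (harmonicOnNhd_fn f) hz hw
  rw [← L2h_enorm_sq] at h1
  have h2 := ENNReal.toReal_mono (by finiteness) h1
  rw [ENNReal.toReal_mul, ENNReal.toReal_mul, ENNReal.toReal_pow, ENNReal.toReal_pow,
    toReal_enorm, toReal_enorm, ENNReal.toReal_ofReal (by positivity)] at h2
  rw [mul_pow (16 * C)]
  exact h2

lemma IsA2Pair.measureReal_ball_pos {μ σ : Measure ℂ} (h : IsA2Pair μ σ C) {z : ℂ}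
    (hz : z ∈ disk) : 0 < μ.real (ball z (1 - ‖z‖)) := by
  have := h.finite
  rw [mem_disk] at hz
  exact ENNReal.toReal_pos (h.measure_ball_pos (by linarith) (ball_subset_disk le_rfl)).ne'
    (by finiteness)

lemma IsA2Pair.norm_fn_le {σ : Measure ℂ} (h : IsA2Pair (weightMeasure ω) σ C) (f : L2h ω)
    {z : ℂ} (hz : z ∈ disk) {w : ℂ} (hw : w ∈ ball z ((1 - ‖z‖) / 2)) :
    ‖fn f w‖ ≤ 16 * C / √((weightMeasure ω).real (ball z (1 - ‖z‖))) * ‖f‖ := by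
  have hm := h.measureReal_ball_pos hz
  have hC := h.pos
  refine le_of_sq_le_sq ?_ (by positivity)
  rw [div_mul_eq_mul_div, div_pow, Real.sq_sqrt hm.le, le_div_iff₀ hm]
  exact h.norm_fn_sq_le f hz hw

/-- Since norm convergence implies locally uniform convergence, `L²_h(ω)` is closed in `L²(ω)`. -/
lemma IsA2Weight.isClosed_L2h (hω : IsA2Weight ω) :
    IsClosed (L2h ω : Set (Lp ℂ 2 (weightMeasure ω))) := by
  obtain ⟨C, hC⟩ := hω.exists_isA2Pair
  refine IsSeqClosed.isClosed fun f F hf hF => ?_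
  set h : ℕ → L2h ω := fun n => ⟨f n, hf n⟩
  set K : ℂ → ℝ := fun z => 16 * C / √((weightMeasure ω).real (ball z (1 - ‖z‖)))
  have hK : ∀ z ∈ disk, ∀ w ∈ ball z ((1 - ‖z‖) / 2), ∀ m n,
      ‖fn (h m) w - fn (h n) w‖ ≤ K z * ‖f m - f n‖ := by
    intro z hz w hw m n
    have hwd : w ∈ disk := ball_subset_disk (w := z) (by rw [mem_disk] at hz; linarith) hw
    have := hω.fn_sub (h m) (h n) hwd
    rw [Pi.sub_apply] at this
    rw [← this]
    exact hC.norm_fn_le (h m - h n) hz hw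
  have hself : ∀ z ∈ disk, z ∈ ball z ((1 - ‖z‖) / 2) := fun z hz => by
    rw [mem_disk] at hz
    exact mem_ball_self (by linarith)
  have hlim : ∀ z ∈ disk, ∃ y, Filter.Tendsto (fun n => fn (h n) z) Filter.atTop (nhds y) := by
    intro z hz
    refine cauchySeq_tendsto_of_complete ?_
    have hc := hF.cauchySeq
    rw [cauchySeq_iff_tendsto_dist_atTop_0] at hc ⊢
    have hc' := hc.const_mul (K z)
    rw [mul_zero] at hc'
    refine squeeze_zero (fun _ => dist_nonneg) (fun p => ?_) hc'
    rw [dist_eq_norm, dist_eq_norm]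
    exact hK z hz z (hself z hz) _ _
  choose! g hg using hlim
  have hbound : ∀ z ∈ disk, ∀ w ∈ ball z ((1 - ‖z‖) / 2), ∀ n,
      ‖fn (h n) w - g w‖ ≤ K z * ‖f n - F‖ := by
    intro z hz w hw n
    have hwd : w ∈ disk := ball_subset_disk (w := z) (by rw [mem_disk] at hz; linarith) hw
    exact le_of_tendsto_of_tendsto' ((tendsto_const_nhds.sub (hg w hwd)).norm)
      ((tendsto_const_nhds.sub hF).norm.const_mul (K z)) fun m => hK z hz w hw n m
  have hunif : TendstoLocallyUniformlyOn (fun n => fn (h n)) g Filter.atTop disk := by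
    rw [Metric.tendstoLocallyUniformlyOn_iff]
    intro ε hε z hz
    refine ⟨ball z ((1 - ‖z‖) / 2), mem_nhdsWithin_of_mem_nhds
      (isOpen_ball.mem_nhds (hself z hz)), ?_⟩
    have h0 : Filter.Tendsto (fun n => K z * ‖f n - F‖) Filter.atTop (nhds 0) := by
      have := (tendsto_iff_norm_sub_tendsto_zero.1 hF).const_mul (K z)
      rwa [mul_zero] at this
    filter_upwards [h0.eventually (gt_mem_nhds hε)] with n hn w hw
    rw [dist_comm, dist_eq_norm]
    exact (hbound z hz w hw n).trans_lt hn
  refine ⟨g, harmonicOnNhd_of_tendstoLocallyUniformlyOn isOpen_disk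
    (fun n => harmonicOnNhd_fn (h n)) hunif, ?_⟩
  obtain ⟨φ, hφ, hae⟩ := (tendstoInMeasure_of_tendsto_Lp hF).exists_seq_tendsto_ae
  have hmem : ∀ᵐ z ∂weightMeasure ω, z ∈ disk := ae_mem_disk hC.compl_disk
  have hall : ∀ᵐ z ∂weightMeasure ω, ∀ n, (f n : ℂ → ℂ) z = fn (h n) z :=
    ae_all_iff.2 fun n => coe_ae_eq_fn (h n)
  filter_upwards [hae, hmem, hall] with z hz hzd hn
  refine tendsto_nhds_unique hz ?_
  simp only [hn]
  exact (hg z hzd).comp hφ.tendsto_atTop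

lemma IsA2Weight.completeSpace_L2h (hω : IsA2Weight ω) : CompleteSpace (L2h ω) :=
  hω.isClosed_L2h.completeSpace_coe

/-- The defining property of the reproducing kernel; the kernel exists by the Riesz representation
theorem, point evaluations being bounded. -/
lemma IsA2Weight.inner_kernel (hω : IsA2Weight ω) {z : ℂ} (hz : z ∈ disk) (f : L2h ω) :
    inner ℂ (kernel ω z) f = fn f z := by
  obtain ⟨C, hC⟩ := hω.exists_isA2Pair
  have := hω.completeSpace_L2h
  have hex : ∃ k : L2h ω, ∀ f : L2h ω, inner ℂ k f = fn f z := by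
    let ℓ : L2h ω →ₗ[ℂ] ℂ :=
      { toFun := fun f => fn f z
        map_add' := fun f g => hω.fn_add f g hz
        map_smul' := fun c f => hω.fn_smul c f hz }
    have hself : z ∈ ball z ((1 - ‖z‖) / 2) := by
      rw [mem_disk] at hz
      exact mem_ball_self (by linarith)
    let L : L2h ω →L[ℂ] ℂ := ℓ.mkContinuous _ fun f => hC.norm_fn_le f hz hself
    exact ⟨(toDual ℂ (L2h ω)).symm L, fun f => toDual_symm_apply⟩
  rw [kernel, dif_pos hex]
  exact hex.choose_spec f

end

/-! ### Pseudohyperbolic disks -/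

lemma measurableSet_pdisk (z : ℂ) (r : ℝ) : MeasurableSet (pdisk z r) :=
  measurableSet_disk.inter (measurableSet_lt
    (((measurable_id.sub_const z).div ((measurable_const_mul (conj z)).const_sub 1)).norm)
    measurable_const)

lemma ball_subset_pdisk {z : ℂ} (hz : z ∈ disk) {r : ℝ} (hr1 : r ≤ 1) :
    ball z (r * (1 - ‖z‖)) ⊆ pdisk z r := by
  have hδ : 0 < 1 - ‖z‖ := by rw [mem_disk] at hz; linarith
  intro w hw
  have hwd : w ∈ disk := ball_subset_disk (w := z) (by nlinarith) hw
  have hp := norm_one_sub_pos hz hwd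
  rw [mem_ball_iff_norm] at hw
  have hr : 0 < r := by
    by_contra! h
    nlinarith [norm_nonneg (w - z)]
  refine ⟨hwd, ?_⟩
  rw [norm_div, div_lt_iff₀ hp]
  exact hw.trans_le (by gcongr; exact one_sub_norm_le hwd)

lemma pdisk_subset_ball {z : ℂ} (hz : z ∈ disk) {r : ℝ} (hr : 0 < r) (hr1 : r ≤ 1 / 4) :
    pdisk z r ⊆ ball z (3 * r * (1 - ‖z‖)) := by
  rintro w ⟨hwd, hw⟩
  have hp := norm_one_sub_pos hz hwd
  rw [norm_div, div_lt_iff₀ hp] at hw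
  rw [mem_disk] at hz
  have h1 : ‖1 - conj z * w‖ ≤ 2 * (1 - ‖z‖) + ‖w - z‖ := by
    have e : 1 - conj z * w = ((1 - ‖z‖ ^ 2 : ℝ) : ℂ) - conj z * (w - z) := by
      push_cast
      rw [← Complex.conj_mul']
      ring
    rw [e]
    refine (norm_sub_le _ _).trans ?_
    rw [Complex.norm_real, norm_mul, Complex.norm_conj, Real.norm_eq_abs,
      abs_of_nonneg (by nlinarith [norm_nonneg z])]
    nlinarith [norm_nonneg z, norm_nonneg (w - z)]
  rw [mem_ball_iff_norm]
  nlinarith [norm_nonneg (w - z)]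

lemma IsA2Pair.measure_ball_le_pdisk {μ σ : Measure ℂ} {C : ℝ} (h : IsA2Pair μ σ C) {z : ℂ}
    (hz : z ∈ disk) {r : ℝ} (hr : 0 < r) (hr1 : r ≤ 1 / 4) :
    μ (ball z (1 - ‖z‖)) ≤ ENNReal.ofReal (C / r ^ 4) * μ (pdisk z r) := by
  have hδ : 0 < 1 - ‖z‖ := by rw [mem_disk] at hz; linarith
  refine h.doubling hz hδ hr ((pdisk_subset_ball hz hr hr1).trans (ball_subset_ball ?_))
    (b := z) (Set.subset_inter (ball_subset_pdisk hz (by linarith))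
      (ball_subset_disk (by nlinarith)))
  nlinarith

/-- A harmonic function whose size near `z` is controlled by its value at `z` is bounded below by
half of that value on a small pseudohyperbolic disk, so that its `L²(ν)` norm controls the
`ν`-measure of that pseudohyperbolic disk. -/
lemma measure_pdisk_mul_le {ν : Measure ℂ} {f : ℂ → ℂ} (hf : HarmonicOnNhd f disk) {z : ℂ}
    (hz : z ∈ disk) {M r : ℝ} (hM : 0 < M) (hb : ∀ w ∈ ball z ((1 - ‖z‖) / 2), ‖f w‖ ≤ M)
    (hr : 0 < r) (hr1 : r ≤ 1 / 12) (hrM : 192 * r * M ≤ ‖f z‖) :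
    ν (pdisk z r) * ENNReal.ofReal (‖f z‖ ^ 2 / 4) ≤ ∫⁻ w, ‖f w‖ₑ ^ 2 ∂ν := by
  have hδ : 0 < 1 - ‖z‖ := by rw [mem_disk] at hz; linarith
  rw [mul_comm, ← setLIntegral_const]
  refine (setLIntegral_mono' (measurableSet_pdisk z r) fun w hw => ?_).trans
    (setLIntegral_le_lintegral _ _)
  have hwz := pdisk_subset_ball hz hr (by linarith) hw
  rw [mem_ball_iff_norm] at hwz
  have h1 := norm_sub_le_of_harmonic_disk hf hz hM hb (w := w) (by nlinarith)
  have h2 : ‖w - z‖ / (1 - ‖z‖) ≤ 3 * r := by rw [div_le_iff₀ hδ]; exact hwz.le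
  have h3 : ‖f w - f z‖ ≤ ‖f z‖ / 2 := by
    calc _ ≤ _ := h1
      _ ≤ 32 * M * (3 * r) := by gcongr
      _ ≤ _ := by linarith
  have h4 : ‖f z‖ / 2 ≤ ‖f w‖ := by
    have := norm_sub_norm_le (f z) (f w)
    rw [norm_sub_rev] at this
    linarith
  rw [enorm_sq_eq_ofReal]
  apply ENNReal.ofReal_le_ofReal
  calc ‖f z‖ ^ 2 / 4 = (‖f z‖ / 2) ^ 2 := by ring
    _ ≤ _ := by gcongr

/-! ### The unweighted kernel as a test function -/

lemma le_norm_R_self {z : ℂ} (hz : z ∈ disk) : 1 / (4 * (1 - ‖z‖) ^ 2) ≤ ‖R z z‖ := by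
  rw [mem_disk] at hz
  have hn := norm_nonneg z
  set u : ℝ := 1 - ‖z‖ ^ 2 with hu
  have hu0 : 0 < u := by rw [hu]; nlinarith
  have hu1 : u ≤ 1 := by rw [hu]; nlinarith
  have e : R z z = ((2 / u ^ 2 - 1 : ℝ) : ℂ) := by
    simp only [R, hu]
    rw [Complex.conj_mul']
    push_cast
    ring
  rw [e, Complex.norm_real, Real.norm_eq_abs]
  refine le_trans ?_ (le_abs_self _)
  have h1 : 1 ≤ 1 / u ^ 2 := by rw [le_div_iff₀ (by positivity)]; nlinarith
  have h2 : 1 / (4 * (1 - ‖z‖) ^ 2) ≤ 1 / u ^ 2 := by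
    apply one_div_le_one_div_of_le (by positivity)
    have : u ≤ 2 * (1 - ‖z‖) := by rw [hu]; nlinarith
    nlinarith
  have h3 : 2 / u ^ 2 = 1 / u ^ 2 + 1 / u ^ 2 := by ring
  linarith

lemma aestronglyMeasurable_of_harmonic {ν : Measure ℂ} (hν : ν diskᶜ = 0) {f : ℂ → ℂ}
    (hf : HarmonicOnNhd f disk) : AEStronglyMeasurable f ν := by
  have := hf.continuousOn.aestronglyMeasurable (μ := ν) measurableSet_disk
  rwa [Measure.restrict_eq_self_of_ae_mem (ae_mem_disk hν)] at this

lemma memLp_R {ν : Measure ℂ} [IsFiniteMeasure ν] (hν : ν diskᶜ = 0) {z : ℂ} (hz : z ∈ disk) :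
    MemLp (R z) 2 ν :=
  MemLp.of_bound (aestronglyMeasurable_of_harmonic hν (harmonicOnNhd_R hz)) _
    ((ae_mem_disk hν).mono fun _ hw => norm_R_le_of_mem hz hw)

lemma lintegral_R_ne_top {ν : Measure ℂ} [IsFiniteMeasure ν] (hν : ν diskᶜ = 0) {z : ℂ}
    (hz : z ∈ disk) : ∫⁻ w, ‖R z w‖ₑ ^ 2 ∂ν ≠ ∞ := by
  have h := memLp_R hν hz
  rw [← enorm_sq_eq_lintegral (h.toLp _) h.coeFn_toLp]
  finiteness

lemma integral_R_eq {ν : Measure ℂ} (hν : ν diskᶜ = 0) {z : ℂ} (hz : z ∈ disk) :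
    ∫ w, ‖R z w‖ ^ 2 ∂ν = (∫⁻ w, ‖R z w‖ₑ ^ 2 ∂ν).toReal := by
  have hm : AEStronglyMeasurable (fun w => ‖R z w‖ ^ 2) ν :=
    (aestronglyMeasurable_of_harmonic hν (harmonicOnNhd_R hz)).norm.pow 2
  rw [integral_eq_lintegral_of_nonneg_ae (Filter.Eventually.of_forall fun _ => by positivity) hm]
  simp only [enorm_sq_eq_ofReal]

section

variable {ω : ℂ → ℝ}

lemma berezin_eq (ω : ℂ → ℝ) {ν : Measure ℂ} (hν : ν diskᶜ = 0) {z : ℂ} (hz : z ∈ disk) :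
    berezin ω ν z = (∫⁻ w, ‖R z w‖ₑ ^ 2 ∂ν).toReal /
      (∫⁻ w, ‖R z w‖ₑ ^ 2 ∂weightMeasure ω).toReal := by
  rw [berezin, integral_R_eq hν hz,
    integral_R_eq (weightMeasure_absolutelyContinuous ω dA_compl_disk) hz, one_div_mul_eq_div]

/-! ### Carleson measures, the Berezin transform and Toeplitz operators -/

lemma lintegral_congr_of_eqOn {ν : Measure ℂ} (hν : ν diskᶜ = 0) {f g : ℂ → ℂ}
    (h : Set.EqOn f g disk) : ∫⁻ w, ‖f w‖ₑ ^ 2 ∂ν = ∫⁻ w, ‖g w‖ₑ ^ 2 ∂ν :=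
  lintegral_congr_ae ((ae_mem_disk hν).mono fun w hw => by simp only [h hw])

lemma IsCarleson.exists_berezin_le {ν : Measure ℂ} (hω : IsA2Weight ω) (hν : ν diskᶜ = 0)
    (h : IsCarleson ω ν) : ∃ C : ℝ, ∀ z ∈ disk, |berezin ω ν z| ≤ C := by
  obtain ⟨C, hC⟩ := h
  obtain ⟨C', hA⟩ := hω.exists_isA2Pair
  have := hA.finite
  refine ⟨C, fun z hz => ?_⟩
  have hm := memLp_R hA.compl_disk hz
  obtain ⟨F, hF⟩ := hω.exists_fn_eqOn (harmonicOnNhd_R hz) hm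
  have h1 := hC F
  rw [L2h_enorm_sq, lintegral_congr_of_eqOn hν hF, lintegral_congr_of_eqOn hA.compl_disk hF] at h1
  have h2 := ENNReal.toReal_mono
    (ENNReal.mul_ne_top ENNReal.coe_ne_top (lintegral_R_ne_top hA.compl_disk hz)) h1
  rw [berezin_eq ω hν hz, abs_of_nonneg (by positivity)]
  refine div_le_of_le_mul₀ (by positivity) (by positivity) ?_
  simpa using h2

lemma exists_pdisk_le_of_berezin_le {ν : Measure ℂ} [IsFiniteMeasure ν] (hω : IsA2Weight ω)
    (hν : ν diskᶜ = 0) {r₀ : ℝ} (hr₀ : 0 < r₀)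
    (h : ∃ C : ℝ, ∀ z ∈ disk, |berezin ω ν z| ≤ C) :
    ∃ r : ℝ, 0 < r ∧ r ≤ r₀ ∧ ∃ C : ℝ≥0, ∀ z ∈ disk,
      ν (pdisk z r) ≤ C * weightMeasure ω (pdisk z r) := by
  obtain ⟨B, hB⟩ := h
  obtain ⟨C, hC⟩ := hω.exists_isA2Pair
  obtain ⟨A, hA, hRA⟩ := hC.exists_lintegral_R_le
  have := hC.finite
  have hC0 := hC.pos
  -- `r` is so small that `192 r sup |R_z| ≤ |R_z(z)|`
  set r := min r₀ (1 / 4608)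
  have hr0 : 0 < r := by positivity
  have hr1 : r ≤ 1 / 4608 := min_le_right _ _
  refine ⟨r, hr0, min_le_left _ _, (64 * B * A * C / r ^ 4).toNNReal, fun z hz => ?_⟩
  have hδ : 0 < 1 - ‖z‖ := by rw [mem_disk] at hz; linarith
  set δ := 1 - ‖z‖
  have hB0 : 0 ≤ B := (abs_nonneg _).trans (hB z hz)
  have hself := le_norm_R_self hz
  have hselfpos : 0 < 1 / (4 * δ ^ 2) := by positivity
  have hsub : ball z (δ / 2) ⊆ disk := ball_subset_disk (w := z) (by linarith)
  have hlow := measure_pdisk_mul_le (ν := ν) (harmonicOnNhd_R hz) hz (M := 6 / δ ^ 2)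
    (by positivity) (fun w hw => norm_R_le_of_mem hz (hsub hw)) hr0 (by linarith) (by
      refine le_trans ?_ hself
      rw [mul_div_assoc', div_le_div_iff₀ (by positivity) (by positivity)]
      nlinarith [pow_pos hδ 2])
  have hμ0 : 0 < (∫⁻ w, ‖R z w‖ₑ ^ 2 ∂weightMeasure ω).toReal := by
    refine ENNReal.toReal_pos (fun h0 => ?_) (lintegral_R_ne_top hC.compl_disk hz)
    have h1 := hC.enorm_sq_mul_measure_ball_le_of_mem (harmonicOnNhd_R hz) hz
      (mem_ball_self (by positivity))
    rw [h0, mul_zero, nonpos_iff_eq_zero, mul_eq_zero] at h1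
    rcases h1 with h1 | h1
    · have : ‖R z z‖ = 0 := by simpa using h1
      rw [this] at hself
      exact absurd hself (not_le.2 hselfpos)
    · exact (hC.measure_ball_pos hδ (ball_subset_disk le_rfl)).ne' h1
  have hber := (le_abs_self _).trans (hB z hz)
  rw [berezin_eq ω hν hz, div_le_iff₀ hμ0] at hber
  have hνμ : ∫⁻ w, ‖R z w‖ₑ ^ 2 ∂ν ≤
      ENNReal.ofReal B * ∫⁻ w, ‖R z w‖ₑ ^ 2 ∂weightMeasure ω := by
    rw [← ENNReal.ofReal_toReal (lintegral_R_ne_top hν hz),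
      ← ENNReal.ofReal_toReal (lintegral_R_ne_top hC.compl_disk hz), ← ENNReal.ofReal_mul hB0]
    exact ENNReal.ofReal_le_ofReal hber
  have h0 : ENNReal.ofReal (1 / (64 * δ ^ 4)) ≠ 0 := by
    simp only [ne_eq, ENNReal.ofReal_eq_zero, not_le]; positivity
  rw [← ENNReal.mul_le_mul_iff_left h0 ENNReal.ofReal_ne_top]
  calc ν (pdisk z r) * ENNReal.ofReal (1 / (64 * δ ^ 4))
      ≤ ν (pdisk z r) * ENNReal.ofReal (‖R z z‖ ^ 2 / 4) := by
        have h64 : 1 / (64 * δ ^ 4) ≤ ‖R z z‖ ^ 2 / 4 :=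
          calc 1 / (64 * δ ^ 4) = (1 / (4 * δ ^ 2)) ^ 2 / 4 := by field_simp; norm_num
            _ ≤ _ := by gcongr
        exact mul_le_mul_right (ENNReal.ofReal_le_ofReal h64) _
    _ ≤ ENNReal.ofReal B * (ENNReal.ofReal (A / δ ^ 4) * (ENNReal.ofReal (C / r ^ 4) *
          weightMeasure ω (pdisk z r))) := by
        refine hlow.trans (hνμ.trans ?_)
        gcongr
        refine (hRA z hz).trans ?_
        gcongr
        exact hC.measure_ball_le_pdisk hz hr0 (by linarith)
    _ = _ := by
        change _ = ENNReal.ofReal _ * _ * _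
        rw [mul_right_comm, ← ENNReal.ofReal_mul (by positivity), ← mul_assoc, ← mul_assoc,
          ← ENNReal.ofReal_mul (by positivity), ← ENNReal.ofReal_mul (by positivity)]
        congr 2
        field_simp

/-- The weighted kernels are tested against `T_ν`: `⟨T K_z, K_z⟩ = ∫ |K_z|² dν`, while `|K_z|` is
comparable to `K_z(z) = ‖K_z‖²` near `z`. The lower bound `‖K_z‖² ≥ c / |B(z, 1 - |z|)|_ω` comes from
evaluating `R_z` at `z`. -/
lemma ToeplitzExtends.exists_pdisk_le {ν : Measure ℂ} (hω : IsA2Weight ω)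
    {𝒟 : Submodule ℂ (L2h ω)} (h𝒟 : ∀ a ∈ disk, kernel ω a ∈ 𝒟) {r₀ : ℝ} (hr₀ : 0 < r₀)
    (h : ToeplitzExtends ω ν 𝒟) :
    ∃ r : ℝ, 0 < r ∧ r ≤ r₀ ∧ ∃ C : ℝ≥0, ∀ z ∈ disk,
      ν (pdisk z r) ≤ C * weightMeasure ω (pdisk z r) := by
  obtain ⟨T, hT⟩ := h
  obtain ⟨C, hC⟩ := hω.exists_isA2Pair
  obtain ⟨A, hA, hRA⟩ := hC.exists_lintegral_R_le
  have := hC.finite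
  have hC0 := hC.pos
  set L := 64 * C * √A with hL
  have hL0 : 0 < L := by positivity
  -- `r` is so small that `192 r sup |K_z| ≤ K_z(z)` near `z`
  set r := min r₀ (min (1 / 12) (1 / (192 * L)))
  have hr0 : 0 < r := by positivity
  have hr12 : r ≤ 1 / 12 := (min_le_right _ _).trans (min_le_left _ _)
  have hrL : r ≤ 1 / (192 * L) := (min_le_right _ _).trans (min_le_right _ _)
  rw [le_div_iff₀ (by positivity)] at hrL
  refine ⟨r, hr0, min_le_left _ _, (64 * ‖T‖ * A * (C / r ^ 4)).toNNReal, fun z hz => ?_⟩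
  have hδ : 0 < 1 - ‖z‖ := by rw [mem_disk] at hz; linarith
  set δ := 1 - ‖z‖
  set k := kernel ω z
  set m := (weightMeasure ω).real (ball z δ) with hm
  have hm0 : 0 < m := hC.measureReal_ball_pos hz
  have hkz : fn k z = ((‖k‖ ^ 2 : ℝ) : ℂ) := by
    rw [← hω.inner_kernel hz k]
    exact (inner_self_eq_norm_sq_to_K (𝕜 := ℂ) k).trans (by simp)
  have hkz' : ‖fn k z‖ = ‖k‖ ^ 2 := by
    rw [hkz, Complex.norm_real, Real.norm_eq_abs, abs_of_nonneg (by positivity)]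
  -- the lower bound for the norm of the kernel
  have hlow : 1 ≤ 4 * ‖k‖ * (√A * √m) := by
    have hmem := memLp_R hC.compl_disk hz
    obtain ⟨F, hF⟩ := hω.exists_fn_eqOn (harmonicOnNhd_R hz) hmem
    have h1 := norm_inner_le_norm (𝕜 := ℂ) k F
    rw [hω.inner_kernel hz, hF hz] at h1
    have h2 : ‖F‖ ^ 2 ≤ A / δ ^ 4 * m := by
      have := hRA z hz
      rw [← lintegral_congr_of_eqOn hC.compl_disk hF, ← L2h_enorm_sq] at this
      have h3 := ENNReal.toReal_mono (by finiteness) this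
      rwa [ENNReal.toReal_pow, toReal_enorm, ENNReal.toReal_mul,
        ENNReal.toReal_ofReal (by positivity)] at h3
    have h4 : ‖F‖ ≤ √A * √m / δ ^ 2 := by
      refine le_of_sq_le_sq (h2.trans_eq ?_) (by positivity)
      rw [div_pow, mul_pow, Real.sq_sqrt hA.le, Real.sq_sqrt hm0.le]
      ring
    have h5 : 1 / (4 * δ ^ 2) ≤ ‖k‖ * (√A * √m / δ ^ 2) :=
      (le_norm_R_self hz).trans (h1.trans (by gcongr))
    rw [mul_div_assoc', div_le_div_iff₀ (by positivity) (by positivity)] at h5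
    have hδ2 : 0 < δ ^ 2 := by positivity
    by_contra! hlt
    nlinarith
  have hk0 : 0 < ‖k‖ := by
    by_contra! h0
    have : ‖k‖ = 0 := le_antisymm h0 (norm_nonneg _)
    rw [this] at hlow
    norm_num at hlow
  have hup : ∀ w ∈ ball z (δ / 2), ‖fn k w‖ ≤ L * ‖k‖ ^ 2 := by
    intro w hw
    refine (hC.norm_fn_le k hz hw).trans ?_
    change 16 * C / √m * ‖k‖ ≤ _
    have hsm : 0 < √m := Real.sqrt_pos.2 hm0
    rw [div_mul_eq_mul_div, div_le_iff₀ hsm]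
    calc 16 * C * ‖k‖ = 16 * C * ‖k‖ * 1 := by ring
      _ ≤ 16 * C * ‖k‖ * (4 * ‖k‖ * (√A * √m)) := by gcongr
      _ = _ := by rw [hL]; ring
  have hpd := measure_pdisk_mul_le (ν := ν) (harmonicOnNhd_fn k) hz (by positivity) hup hr0 hr12
    (by rw [hkz', ← mul_assoc]; nlinarith [sq_nonneg ‖k‖])
  obtain ⟨hint, hval⟩ := hT k (h𝒟 z hz) z hz
  have hkk : ∀ w, fn k w * conj (fn k w) = ((‖fn k w‖ ^ 2 : ℝ) : ℂ) := fun w => by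
    rw [Complex.mul_conj']
    push_cast
    rfl
  have hν : ∫⁻ w, ‖fn k w‖ₑ ^ 2 ∂ν ≤ ENNReal.ofReal (‖T‖ * ‖k‖ ^ 2) := by
    have h1 : ∫⁻ w, ‖fn k w‖ₑ ^ 2 ∂ν = ENNReal.ofReal (∫ w, ‖fn k w‖ ^ 2 ∂ν) := by
      have hi : Integrable (fun w => ((‖fn k w‖ ^ 2 : ℝ) : ℂ)) ν :=
        hint.congr (Filter.Eventually.of_forall hkk)
      have := ofReal_integral_norm_eq_lintegral_enorm hi
      simp only [Complex.norm_real, norm_pow, norm_norm] at this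
      rw [this]
      refine lintegral_congr fun w => ?_
      rw [enorm_sq_eq_ofReal, ← ofReal_norm, Complex.norm_real, norm_pow, norm_norm]
    rw [h1]
    apply ENNReal.ofReal_le_ofReal
    have h2 : fn (T k) z = ((∫ w, ‖fn k w‖ ^ 2 ∂ν : ℝ) : ℂ) := by
      rw [hval, ← integral_complex_ofReal]
      exact integral_congr_ae (Filter.Eventually.of_forall fun w => hkk w)
    have h3 := norm_inner_le_norm (𝕜 := ℂ) k (T k)
    rw [hω.inner_kernel hz, h2, Complex.norm_real, Real.norm_eq_abs] at h3
    calc _ ≤ _ := le_abs_self _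
      _ ≤ _ := h3
      _ ≤ ‖k‖ * (‖T‖ * ‖k‖) := by gcongr; exact T.le_opNorm k
      _ = _ := by ring
  have h0 : ENNReal.ofReal (‖fn k z‖ ^ 2 / 4) ≠ 0 := by
    rw [hkz']
    simp only [ne_eq, ENNReal.ofReal_eq_zero, not_le]; positivity
  rw [← ENNReal.mul_le_mul_iff_left h0 ENNReal.ofReal_ne_top]
  have hlow2 : 1 ≤ 16 * ‖k‖ ^ 2 * (A * m) := by
    have h1 : (1 : ℝ) ≤ (4 * ‖k‖ * (√A * √m)) ^ 2 := one_le_pow₀ hlow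
    rw [mul_pow, mul_pow, mul_pow, Real.sq_sqrt hA.le, Real.sq_sqrt hm0.le] at h1
    linarith
  calc _ ≤ ENNReal.ofReal (‖T‖ * ‖k‖ ^ 2) := hpd.trans hν
    _ ≤ ENNReal.ofReal (64 * ‖T‖ * A * m * (‖fn k z‖ ^ 2 / 4)) := by
        apply ENNReal.ofReal_le_ofReal
        rw [hkz']
        calc ‖T‖ * ‖k‖ ^ 2 = ‖T‖ * ‖k‖ ^ 2 * 1 := by ring
          _ ≤ ‖T‖ * ‖k‖ ^ 2 * (16 * ‖k‖ ^ 2 * (A * m)) := by gcongr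
          _ = _ := by ring
    _ = ENNReal.ofReal (64 * ‖T‖ * A) * weightMeasure ω (ball z δ) *
          ENNReal.ofReal (‖fn k z‖ ^ 2 / 4) := by
        rw [ENNReal.ofReal_mul (by positivity), ENNReal.ofReal_mul (by positivity), hm,
          ofReal_measureReal (by finiteness)]
    _ ≤ ENNReal.ofReal (64 * ‖T‖ * A) * (ENNReal.ofReal (C / r ^ 4) *
          weightMeasure ω (pdisk z r)) * ENNReal.ofReal (‖fn k z‖ ^ 2 / 4) := by
        gcongr
        exact hC.measure_ball_le_pdisk hz hr0 (by linarith)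
    _ = _ := by
        rw [← mul_assoc (ENNReal.ofReal (64 * ‖T‖ * A)), ← ENNReal.ofReal_mul (by positivity)]
        rfl

/-- The pointwise bound on small Euclidean balls `B(w, r(1 - |w|)/4)` is integrated against `ν` and
the order of integration is exchanged; if `v` lies in the ball around `w`, then `w` lies in
`D(v, r)`, and the two sets have comparable `ω`-measure. -/
lemma isCarleson_of_pdisk_le {ν : Measure ℂ} [IsFiniteMeasure ν] (hω : IsA2Weight ω)
    (hν : ν diskᶜ = 0) {r : ℝ} (hr : 0 < r) (hr1 : r ≤ 1 / 4) {C₀ : ℝ≥0}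
    (h : ∀ z ∈ disk, ν (pdisk z r) ≤ C₀ * weightMeasure ω (pdisk z r)) : IsCarleson ω ν := by
  obtain ⟨C, hC⟩ := hω.exists_isA2Pair
  have := hC.finite
  have hC0 := hC.pos
  set μ := weightMeasure ω
  set E : Set (ℂ × ℂ) := {p | ‖p.2 - p.1‖ < r * (1 - ‖p.1‖) / 4} with hE
  have hEm : MeasurableSet E := (isOpen_lt (by fun_prop) (by fun_prop)).measurableSet
  set B : ℂ → Set ℂ := fun w => ball w (r * (1 - ‖w‖) / 4) with hB
  have hEB : ∀ w, Prod.mk w ⁻¹' E = B w := fun w => by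
    ext v
    simp [hE, hB, dist_eq_norm]
  have hBm : Measurable fun w => μ (B w) := by
    simp only [← hEB]
    exact measurable_measure_prodMk_left hEm
  set K := ENNReal.ofReal (C / (r / 8) ^ 4) with hK
  refine ⟨C.toNNReal * ((C / (r / 8) ^ 4).toNNReal * C₀), fun f => ?_⟩
  set F : ℂ → ℝ≥0∞ := disk.indicator fun z => ‖fn f z‖ₑ ^ 2 with hF
  have hFm : Measurable F := by
    classical
    have h1 : Measurable (disk.indicator (fn f)) := by
      rw [← Set.piecewise_eq_indicator]
      exact (harmonicOnNhd_fn f).continuousOn.measurable_piecewise continuousOn_const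
        measurableSet_disk
    convert h1.enorm.pow_const 2 using 1
    ext z
    by_cases hz : z ∈ disk <;> simp [hF, hz]
  set Φ : ℂ → ℂ → ℝ≥0∞ := fun w v => (μ (B w))⁻¹ * E.indicator 1 (w, v) * F v with hΦ
  have hpoint : ∀ w ∈ disk, ‖fn f w‖ₑ ^ 2 ≤ ENNReal.ofReal C * ∫⁻ v, Φ w v ∂μ := by
    intro w hw
    have hw1 : ‖w‖ < 1 := mem_disk.1 hw
    have ht : 0 < r * (1 - ‖w‖) / 4 := by
      have : 0 < 1 - ‖w‖ := by linarith
      positivity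
    have hsub : B w ⊆ disk := ball_subset_disk (by nlinarith)
    have h1 := hC.enorm_sq_mul_measure_ball_le (harmonicOnNhd_fn f) hw ht hsub
    have hpos : μ (B w) ≠ 0 := (hC.measure_ball_pos ht hsub).ne'
    have h2 : ∫⁻ v, Φ w v ∂μ = (μ (B w))⁻¹ * ∫⁻ v in B w, ‖fn f v‖ₑ ^ 2 ∂μ := by
      rw [← lintegral_indicator measurableSet_ball,
        ← lintegral_const_mul' _ _ (ENNReal.inv_ne_top.2 hpos)]
      refine lintegral_congr fun v => ?_
      have hvE : (w, v) ∈ E ↔ v ∈ B w := by rw [← hEB]; rfl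
      by_cases hv : v ∈ B w
      · rw [show (ball w _).indicator (fun z => ‖fn f z‖ₑ ^ 2) v = ‖fn f v‖ₑ ^ 2 from
          Set.indicator_of_mem hv _]
        simp only [hΦ, hF, Set.indicator_of_mem (hvE.2 hv), Set.indicator_of_mem (hsub hv),
          Pi.one_apply, mul_one]
      · rw [show (ball w _).indicator (fun z => ‖fn f z‖ₑ ^ 2) v = 0 from
          Set.indicator_of_notMem hv _]
        simp only [hΦ, Set.indicator_of_notMem (fun h => hv (hvE.1 h)), mul_zero, zero_mul]
    rw [h2, mul_left_comm, mul_comm (μ (B w))⁻¹, ← div_eq_mul_inv,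
      ENNReal.le_div_iff_mul_le (Or.inl hpos) (Or.inl (by finiteness))]
    exact h1
  have hinner : ∀ v ∈ disk, ∫⁻ w, Φ w v ∂ν ≤ K * C₀ * F v := by
    intro v hv
    have hv1 : ‖v‖ < 1 := mem_disk.1 hv
    have hδ : 0 < 1 - ‖v‖ := by linarith
    have hgeom : ∀ w, (w, v) ∈ E → w ∈ pdisk v r ∧ (μ (B w))⁻¹ ≤ K * (μ (pdisk v r))⁻¹ := by
      intro w hw
      have hwv : ‖v - w‖ < r * (1 - ‖w‖) / 4 := hw
      have h1 : ‖w‖ ≤ ‖v‖ + ‖v - w‖ := by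
        have := norm_sub_norm_le w v
        rw [norm_sub_rev] at this
        linarith
      have h2 : ‖v‖ ≤ ‖w‖ + ‖v - w‖ := by
        have := norm_sub_norm_le v w
        linarith
      have hw0 : 0 < 1 - ‖w‖ := by
        by_contra! h0
        nlinarith [norm_nonneg (v - w)]
      have h3 : 1 - ‖w‖ ≤ 2 * (1 - ‖v‖) := by nlinarith
      have h4 : 1 - ‖v‖ ≤ 2 * (1 - ‖w‖) := by nlinarith
      have hrw : r * (1 - ‖w‖) ≤ 1 / 4 * (1 - ‖w‖) := by gcongr
      refine ⟨ball_subset_pdisk hv (by linarith) ?_, ?_⟩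
      · rw [mem_ball_iff_norm, norm_sub_rev]
        nlinarith
      · have hd := hC.doubling (b := w) hv hδ (κ := r / 8) (by positivity) (E := B w)
          (ball_subset_ball' (by rw [dist_eq_norm, norm_sub_rev]; linarith))
          (Set.subset_inter (ball_subset_ball (by nlinarith))
            (ball_subset_disk (by nlinarith)))
        have hsub : pdisk v r ⊆ ball v (1 - ‖v‖) :=
          (pdisk_subset_ball hv hr hr1).trans (ball_subset_ball (by nlinarith))
        have hd' : μ (pdisk v r) ≤ K * μ (B w) := (measure_mono hsub).trans hd
        have hK0 : K ≠ 0 := by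
          simp only [hK, ne_eq, ENNReal.ofReal_eq_zero, not_le]; positivity
        have hKt : K ≠ ∞ := ENNReal.ofReal_ne_top
        calc (μ (B w))⁻¹ = K * (K * μ (B w))⁻¹ := by
              rw [ENNReal.mul_inv (Or.inl hK0) (Or.inl hKt), ← mul_assoc,
                ENNReal.mul_inv_cancel hK0 hKt, one_mul]
          _ ≤ _ := by gcongr
    have hle : ∀ w, Φ w v ≤
        (pdisk v r).indicator (fun _ => K * (μ (pdisk v r))⁻¹ * F v) w := by
      intro w
      by_cases hw : (w, v) ∈ E
      · obtain ⟨h1, h2⟩ := hgeom w hw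
        simp only [hΦ, Set.indicator_of_mem hw, Set.indicator_of_mem h1, Pi.one_apply, mul_one]
        gcongr
      · simp [hΦ, hw]
    have hball : ball v (r * (1 - ‖v‖)) ⊆ pdisk v r := ball_subset_pdisk hv (by linarith)
    have hpos : μ (pdisk v r) ≠ 0 :=
      ((hC.measure_ball_pos (by positivity) (hball.trans fun _ h => h.1)).trans_le
        (measure_mono hball)).ne'
    calc _ ≤ _ := lintegral_mono hle
      _ = K * (μ (pdisk v r))⁻¹ * F v * ν (pdisk v r) := by
          rw [lintegral_indicator (measurableSet_pdisk v r), setLIntegral_const]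
      _ ≤ K * (μ (pdisk v r))⁻¹ * F v * (C₀ * μ (pdisk v r)) := by gcongr; exact h v hv
      _ = K * C₀ * F v * ((μ (pdisk v r))⁻¹ * μ (pdisk v r)) := by ring
      _ = _ := by rw [ENNReal.inv_mul_cancel hpos (by finiteness), mul_one]
  calc ∫⁻ w, ‖fn f w‖ₑ ^ 2 ∂ν ≤ ∫⁻ w, ENNReal.ofReal C * ∫⁻ v, Φ w v ∂μ ∂ν :=
        lintegral_mono_ae ((ae_mem_disk hν).mono hpoint)
    _ = ENNReal.ofReal C * ∫⁻ v, ∫⁻ w, Φ w v ∂ν ∂μ := by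
        rw [lintegral_const_mul' _ _ ENNReal.ofReal_ne_top, lintegral_lintegral_swap]
        have h1 : Measurable (E.indicator (1 : ℂ × ℂ → ℝ≥0∞)) := measurable_one.indicator hEm
        exact (((hBm.comp measurable_fst).inv.mul h1).mul
          (hFm.comp measurable_snd)).aemeasurable
    _ ≤ ENNReal.ofReal C * ∫⁻ v, K * C₀ * F v ∂μ :=
        mul_le_mul_right (lintegral_mono_ae ((ae_mem_disk hC.compl_disk).mono hinner)) _
    _ ≤ ENNReal.ofReal C * (K * C₀ * ∫⁻ v, ‖fn f v‖ₑ ^ 2 ∂μ) := by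
        rw [lintegral_const_mul _ hFm]
        gcongr
        exact Set.indicator_le_self' (fun _ _ => zero_le) _
    _ = _ := by
        rw [L2h_enorm_sq, ← mul_assoc]
        rfl

/-- With `ι : L²_h(ω) → L²(ν)` the Carleson embedding, the bounded operator `ι* ι` extends `T_ν`. -/
lemma IsCarleson.toeplitzExtends {ν : Measure ℂ} (hω : IsA2Weight ω) (hν : ν diskᶜ = 0)
    (h : IsCarleson ω ν) (𝒟 : Submodule ℂ (L2h ω)) : ToeplitzExtends ω ν 𝒟 := by
  obtain ⟨C, hC⟩ := h
  have := hω.completeSpace_L2h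
  have hmem : ∀ f : L2h ω, MemLp (fn f) 2 ν := fun f => by
    refine ⟨aestronglyMeasurable_of_harmonic hν (harmonicOnNhd_fn f), ?_⟩
    have h1 := eLpNorm_nnreal_pow_eq_lintegral (f := fn f) (μ := ν) (p := 2) (by norm_num)
    simp only [NNReal.coe_ofNat, ENNReal.rpow_ofNat, ENNReal.coe_ofNat] at h1
    have h2 : eLpNorm (fn f) 2 ν ^ 2 < ∞ := by
      rw [h1]
      exact (hC f).trans_lt (by finiteness)
    by_contra h3
    rw [not_lt_top_iff.1 h3] at h2
    simp at h2
  let ι₀ : L2h ω →ₗ[ℂ] Lp ℂ 2 ν :=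
    { toFun := fun f => (hmem f).toLp
      map_add' := fun f g => by
        rw [← MemLp.toLp_add, MemLp.toLp_eq_toLp_iff]
        exact (ae_mem_disk hν).mono fun w hw => hω.fn_add f g hw
      map_smul' := fun c f => by
        rw [RingHom.id_apply, ← MemLp.toLp_const_smul, MemLp.toLp_eq_toLp_iff]
        exact (ae_mem_disk hν).mono fun w hw => hω.fn_smul c f hw }
  have hι₀ : ∀ f, ι₀ f =ᵐ[ν] fn f := fun f => (hmem f).coeFn_toLp
  let ι : L2h ω →L[ℂ] Lp ℂ 2 ν := ι₀.mkContinuous (√C) fun f => by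
    refine le_of_sq_le_sq ?_ (by positivity)
    rw [mul_pow, Real.sq_sqrt C.coe_nonneg]
    have h1 := hC f
    rw [← enorm_sq_eq_lintegral (ι₀ f) (hι₀ f)] at h1
    have h2 := ENNReal.toReal_mono (by finiteness) h1
    simpa using h2
  refine ⟨ι.adjoint ∘L ι, fun f _ z hz => ?_⟩
  have hcongr : (fun w => inner ℂ (ι (kernel ω z) w) (ι f w)) =ᵐ[ν]
      fun w => fn f w * conj (fn (kernel ω z) w) := by
    filter_upwards [hι₀ f, hι₀ (kernel ω z)] with w h1 h2
    change inner ℂ (ι₀ (kernel ω z) w) (ι₀ f w) = _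
    rw [h1, h2, RCLike.inner_apply]
  refine ⟨(L2.integrable_inner (𝕜 := ℂ) (ι (kernel ω z)) (ι f)).congr hcongr, ?_⟩
  rw [← hω.inner_kernel hz, ContinuousLinearMap.comp_apply,
    ContinuousLinearMap.adjoint_inner_right, L2.inner_def]
  exact integral_congr_ae hcongr

end

end HarmonicBergman

theorem mainTheorem1 (ω : ℂ → ℝ) (hω : HarmonicBergman.IsA2Weight ω)
    (ν : Measure ℂ) [IsFiniteMeasure ν] (hν : ν HarmonicBergman.diskᶜ = 0)
    (𝒟 : Submodule ℂ (HarmonicBergman.L2h ω))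
    (h𝒟 : ∀ a ∈ HarmonicBergman.disk, HarmonicBergman.kernel ω a ∈ 𝒟)
    (r₀ : ℝ) (hr₀ : 0 < r₀) (hr₀' : r₀ ≤ 1 / 4) :
    List.TFAE [
      HarmonicBergman.ToeplitzExtends ω ν 𝒟,
      HarmonicBergman.IsCarleson ω ν,
      ∃ r : ℝ, 0 < r ∧ r ≤ r₀ ∧ ∃ C : ℝ≥0, ∀ z ∈ HarmonicBergman.disk,
        ν (HarmonicBergman.pdisk z r) ≤
          C * HarmonicBergman.weightMeasure ω (HarmonicBergman.pdisk z r),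
      ∃ C : ℝ, ∀ z ∈ HarmonicBergman.disk, |HarmonicBergman.berezin ω ν z| ≤ C] := by
  tfae_have 1 → 3 := fun h => h.exists_pdisk_le hω h𝒟 hr₀
  tfae_have 3 → 2 := fun ⟨_, hr, hrr, _, h⟩ =>
    HarmonicBergman.isCarleson_of_pdisk_le hω hν hr (hrr.trans hr₀') h
  tfae_have 2 → 1 := fun h => h.toeplitzExtends hω hν 𝒟
  tfae_have 2 → 4 := fun h => h.exists_berezin_le hω hν
  tfae_have 4 → 3 := HarmonicBergman.exists_pdisk_le_of_berezin_le hω hν hr₀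
  tfae_finish
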